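/- Consider the budget-restricted random graph process: the $\binom n2$ edges of the complete graph $K_n$ on $[n]$ are presented to Builder one at a time, in uniformly random order, and Builder must decide irrevocably, on being shown an edge, whether to purchase it. For integers $0\le t\le\binom n2$ and $b\ge 0$, a $(t,b)$-strategy is an online rule, deterministic or randomized, by which Builder observes the first $t$ edges only and purchases at most $b$ of them; each decision may use the edge presented and all edges presented before it. Let $B_s$ denote the graph on $[n]$ formed by the edges purchased among the first $s$ presented edges, and let $K_4^-$ (the diamond) be the complete graph on four vertices with one edge removed. For functions $f,g$ of $n$ write $f=o(g)$, equivalently $g=\omega(f)$, if $f(n)/g(n)\to 0$ as $n\to\infty$. **Theorem.** Let $t=t(n)$ and $b=b(n)$ be integers with $0\le t\le\binom n2$ and $b\ge 0$, and let $$b^*=b^*(n,t)=\max\left\{\frac{n^6}{t^4},\ \frac{n^{4/3}}{t^{2/3}}\right\}\qquad(b^*=\infty\text{ if }t=0).$$ 1. If $t=\omega(n^{6/5})$ and $b=\omega(b^*)$, then there exists a $(t,b)$-strategy of Builder such that $$\lim_{n\to\infty}\mathbb P\left(K_4^-\subseteq B_t\right)=1 .$$ Moreover, the strategy can be chosen deterministic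 and such that its decision about the edge presented at time $s$ depends only on $s$, on that edge and on $B_{s-1}$. 2. If $t=o(n^{6/5})$ or $b=o(b^*)$, then for every $(t,b)$-strategy of Builder (deterministic or randomized), $$\lim_{n\to\infty}\mathbb P\left(K_4^-\subseteq B_t\right)=0 .$$ Here a $(t,b)$-strategy means a choice of one for each $n$, and $K_4^-\subseteq B_t$ means that $B_t$ contains a (not necessarily induced) copy of $K_4^-$. -/

import Mathlib

open Filter Topology

/-- The edges of the complete graph on the vertex set `Fin n`. -/
abbrev KEdge (n : ℕ) : Type := {e : Sym2 (Fin n) // ¬ e.IsDiag}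

/-- An ordering of the edges of the complete graph on `n` vertices. The edge `σ i` is the one that
is presented to Builder at time `i + 1`. -/
abbrev EdgeOrder (n : ℕ) : Type := Fin (n.choose 2) ≃ KEdge n

instance EdgeOrder.instNonempty (n : ℕ) : Nonempty (EdgeOrder n) :=
  ⟨Fintype.equivOfCardEq (by rw [Fintype.card_fin, Sym2.card_subtype_not_diag, Fintype.card_fin])⟩

/-- A deterministic `(t, b)`-strategy of Builder on `n` vertices: an online rule, which may use all
the edges presented so far, for purchasing at most `b` of the first `t` edges. -/
structure Strategy (n t b : ℕ) where
  /-- The set of indices of the edges that Builder purchases when the edges arrive in order `σ`. -/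
  buys : EdgeOrder n → Finset (Fin (n.choose 2))
  /-- Only the first `t` edges are observed. -/
  lt_time : ∀ σ, ∀ i ∈ buys σ, i.val < t
  /-- At most `b` edges are purchased. -/
  card_le : ∀ σ, (buys σ).card ≤ b
  /-- The decision about an edge is made when it is presented, knowing only this edge and the
  edges presented before it. -/
  online : ∀ σ τ i, (∀ j ≤ i, σ j = τ j) → (i ∈ buys σ ↔ i ∈ buys τ)

namespace Strategy

variable {n t b : ℕ}

/-- Builder's graph `B_s`: the graph on `Fin n` formed by the edges purchased among the first `s`
edges of the order `σ`. -/
def graphAt (B : Strategy n t b) (σ : EdgeOrder n) (s : ℕ) : SimpleGraph (Fin n) :=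
  SimpleGraph.fromEdgeSet {e | ∃ i ∈ B.buys σ, i.val < s ∧ (σ i : Sym2 (Fin n)) = e}

/-- The decision about the edge presented at time `s` depends only on `s`, on this edge and on
Builder's current graph `B_{s-1}` (and not on the edges that were seen but not purchased). -/
def IsGraphBased (B : Strategy n t b) : Prop :=
  ∀ (σ τ : EdgeOrder n) (i : Fin (n.choose 2)), σ i = τ i → B.graphAt σ i = B.graphAt τ i →
    (i ∈ B.buys σ ↔ i ∈ B.buys τ)

end Strategy

/-- A randomized `(t, b)`-strategy: a random choice, independent of the order of the edges, of a
deterministic one. (Coin flips made along the way can be made in advance.) -/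
abbrev RandomizedStrategy (n t b : ℕ) : Type := PMF (Strategy n t b)

/-- The law of Builder's final graph `B_t` when the edges arrive in uniformly random order. -/
noncomputable def RandomizedStrategy.finalGraph {n t b : ℕ} (B : RandomizedStrategy n t b) :
    PMF (SimpleGraph (Fin n)) :=
  PMF.bind B fun S => (PMF.uniformOfFintype (EdgeOrder n)).map fun σ => S.graphAt σ t

/-- The graph `K₄⁻` (the diamond): the complete graph on four vertices minus one edge. -/
def diamond : SimpleGraph (Fin 4) := (⊤ : SimpleGraph (Fin 4)).deleteEdges {s(0, 1)}

/-- The probability that Builder's final graph contains a (not necessarily induced) copy of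
`K₄⁻`. -/
noncomputable def RandomizedStrategy.probDiamond {n t b : ℕ} (B : RandomizedStrategy n t b) : ℝ :=
  (B.finalGraph.toOuterMeasure {G | diamond.IsContained G}).toReal

/-- The budget threshold `b* = max {n⁶ / t⁴, n^(4/3) / t^(2/3)}`. -/
noncomputable def budgetThreshold (n t : ℕ) : ℝ :=
  max ((n : ℝ) ^ 6 / (t : ℝ) ^ 4) ((n : ℝ) ^ (4 / 3 : ℝ) / (t : ℝ) ^ (2 / 3 : ℝ))

/-! Put N = C(n,2) and q = t/n².

Upper bounds. The expected number of diamonds among the first t edges is of order n⁴q⁵ = t⁵/n⁶,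
which settles t = o(n^(6/5)) (`Strategy.orderProb_diamond_le_first_moment`). For the budget, look at
two decisive edges of a purchased diamond (`Strategy.exists_threat_of_diamond`). If the spine comes
last, it is preceded by an edge closing a four-cycle over a path of three purchased edges. If an
outer edge comes last, a triangle was closed earlier over a purchased cherry, and the last edge
completes a pendant edge at that triangle to a second triangle. If all degrees are at most D, there
are at most 2bD² such paths, and at most 2bD cherries, each closed triangle having at most D pendant
edges at a given vertex. Given the past, the next edge is uniform among the unseen ones, so each of
the two completions has probability O(1/N) (`sub_mul_orderAvg_next_le`). Summing over pairs of times
gives O(bD²(t/N)²) (`Strategy.orderProb_diamond_le`). The trivial choice D = b yields b³t²/n⁴, and D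
of order t/n, valid with high probability once t ≥ n^(11/10), yields bt⁴/n⁶. These are the two terms
of the threshold; smaller t is covered by the first moment.

Lower bound. Fix k centres and three classes of m leaf candidates. In the first half of the time,
buy the centre-leaf edges; in the second half, buy edges between consecutive classes whose ends were
joined to a common centre. A centre c and leaves u, v, w with uv and vw bought form a diamond with
spine cv. About km³q⁵ of them are expected, and the second moment method (`orderProb_no_diamond_le`)
produces one with high probability. The expected cost is O(kmq + km²q³), and Markov's inequality
shows that the budget is rarely reached. One centre with m near q^(-5/3) costs about q^(-2/3) =
n^(4/3)/t^(2/3). If that many leaves do not fit into n vertices, m of order n and k near 1/(n³q⁵)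
cost about 1/(n²q⁴) = n⁶/t⁴ (`exists_parameters`). -/

/-! ### Averages over a uniformly random order -/

/-- The average of `f` over a uniformly random order of the edges. -/
noncomputable def orderAvg {n : ℕ} (f : EdgeOrder n → ℝ) : ℝ :=
  (∑ σ, f σ) / (Fintype.card (EdgeOrder n) : ℝ)

open Classical in
/-- The probability that a uniformly random order of the edges satisfies `P`. -/
noncomputable def orderProb {n : ℕ} (P : EdgeOrder n → Prop) : ℝ :=
  orderAvg fun σ => if P σ then 1 else 0

section orderAvg

variable {n : ℕ}

lemma card_edgeOrder_pos (n : ℕ) : (0 : ℝ) < (Fintype.card (EdgeOrder n) : ℝ) := by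
  exact_mod_cast Fintype.card_pos

lemma orderAvg_mono {f g : EdgeOrder n → ℝ} (h : ∀ σ, f σ ≤ g σ) : orderAvg f ≤ orderAvg g :=
  div_le_div_of_nonneg_right (Finset.sum_le_sum fun σ _ => h σ) (card_edgeOrder_pos n).le

lemma orderAvg_add (f g : EdgeOrder n → ℝ) :
    orderAvg (fun σ => f σ + g σ) = orderAvg f + orderAvg g := by
  simp [orderAvg, Finset.sum_add_distrib, add_div]

lemma orderAvg_mul_left (c : ℝ) (f : EdgeOrder n → ℝ) :
    orderAvg (fun σ => c * f σ) = c * orderAvg f := by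
  simp [orderAvg, ← Finset.mul_sum, mul_div_assoc]

lemma orderAvg_const (c : ℝ) : orderAvg (fun _ : EdgeOrder n => c) = c := by
  have := (card_edgeOrder_pos n).ne'
  simp only [orderAvg, Finset.sum_const, Finset.card_univ, nsmul_eq_mul]
  field_simp

lemma orderAvg_sum {ι : Type*} (s : Finset ι) (f : ι → EdgeOrder n → ℝ) :
    orderAvg (fun σ => ∑ i ∈ s, f i σ) = ∑ i ∈ s, orderAvg (f i) := by
  simp only [orderAvg]
  rw [Finset.sum_comm, Finset.sum_div]

lemma orderAvg_nonneg {f : EdgeOrder n → ℝ} (h : ∀ σ, 0 ≤ f σ) : 0 ≤ orderAvg f :=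
  div_nonneg (Finset.sum_nonneg fun σ _ => h σ) (card_edgeOrder_pos n).le

lemma orderProb_nonneg (P : EdgeOrder n → Prop) : 0 ≤ orderProb P :=
  orderAvg_nonneg fun σ => by split_ifs <;> norm_num

lemma orderProb_le_one (P : EdgeOrder n → Prop) : orderProb P ≤ 1 := by
  rw [← orderAvg_const (n := n) 1]
  exact orderAvg_mono fun σ => by split_ifs <;> norm_num

open Classical in
lemma orderProb_le_orderAvg {P : EdgeOrder n → Prop} {f : EdgeOrder n → ℝ} (h0 : ∀ σ, 0 ≤ f σ)
    (h : ∀ σ, P σ → 1 ≤ f σ) : orderProb P ≤ orderAvg f :=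
  orderAvg_mono fun σ => by split_ifs with hP; exacts [h σ hP, h0 σ]

lemma orderProb_mono {P Q : EdgeOrder n → Prop} (h : ∀ σ, P σ → Q σ) :
    orderProb P ≤ orderProb Q := by
  classical
  refine orderProb_le_orderAvg (fun σ => ?_) fun σ hσ => ?_
  · split_ifs <;> norm_num
  · rw [if_pos (h σ hσ)]

lemma orderProb_or_le (P Q : EdgeOrder n → Prop) :
    orderProb (fun σ => P σ ∨ Q σ) ≤ orderProb P + orderProb Q := by
  classical
  unfold orderProb
  rw [← orderAvg_add]
  refine orderAvg_mono fun σ => ?_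
  by_cases hP : P σ <;> by_cases hQ : Q σ <;> simp [hP, hQ]

lemma orderProb_exists_le {ι : Type*} (s : Finset ι) (P : ι → EdgeOrder n → Prop) :
    orderProb (fun σ => ∃ i ∈ s, P i σ) ≤ ∑ i ∈ s, orderProb (P i) := by
  classical
  unfold orderProb
  rw [← orderAvg_sum]
  refine orderProb_le_orderAvg (fun σ => Finset.sum_nonneg fun i _ => ?_) fun σ hσ => ?_
  · split_ifs <;> norm_num
  · obtain ⟨i, hi, hP⟩ := hσ
    refine le_trans ?_ (Finset.single_le_sum
      (f := fun i => if P i σ then (1 : ℝ) else 0) (fun i _ => ?_) hi)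
    · simp [hP]
    · split_ifs <;> norm_num

lemma orderProb_compl (P : EdgeOrder n → Prop) : orderProb (fun σ => ¬ P σ) = 1 - orderProb P := by
  classical
  have : orderProb (fun σ => ¬ P σ) + orderProb P = 1 := by
    unfold orderProb
    rw [← orderAvg_add]
    refine Eq.trans ?_ (orderAvg_const (n := n) 1)
    congr 1
    funext σ
    by_cases hP : P σ <;> simp [hP]
  linarith

open Classical in
lemma orderProb_eq_card_div (P : EdgeOrder n → Prop) :
    orderProb P =
      ((Finset.univ.filter P).card : ℝ) / (Fintype.card (EdgeOrder n) : ℝ) := by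
  simp [orderProb, orderAvg]

/-- Markov's inequality for a counting variable. -/
lemma orderProb_lt_le {f : EdgeOrder n → ℝ} (h0 : ∀ σ, 0 ≤ f σ) {c : ℝ} (hc : 0 < c) :
    orderProb (fun σ => c < f σ) ≤ orderAvg f / c := by
  have : orderAvg f / c = orderAvg fun σ => c⁻¹ * f σ := by
    rw [orderAvg_mul_left]; ring
  rw [this]
  refine orderProb_le_orderAvg (fun σ => mul_nonneg (inv_nonneg.2 hc.le) (h0 σ)) fun σ hσ => ?_
  rw [inv_mul_eq_div, le_div_iff₀ hc]
  linarith

/-- The second moment bound for the probability that a variable vanishes. -/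
lemma orderProb_eq_zero_le {f : EdgeOrder n → ℝ} {μ : ℝ} (hμ : 0 < μ) (h : μ ≤ orderAvg f) :
    orderProb (fun σ => f σ = 0) ≤ orderAvg (fun σ => f σ ^ 2) / μ ^ 2 - 1 := by
  have h1 : orderProb (fun σ => f σ = 0) ≤ orderAvg fun σ => (μ ^ 2)⁻¹ * (f σ - μ) ^ 2 := by
    refine orderProb_le_orderAvg (fun σ => by positivity) fun σ hσ => ?_
    rw [hσ, zero_sub, neg_sq, inv_mul_cancel₀ (by positivity)]
  have h2 : orderAvg (fun σ => (f σ - μ) ^ 2) =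
      orderAvg (fun σ => f σ ^ 2) + (-(2 * μ) * orderAvg f + μ ^ 2) := by
    rw [← orderAvg_mul_left, ← orderAvg_const (n := n) (μ ^ 2), ← orderAvg_add, ← orderAvg_add]
    congr 1; funext σ; ring
  rw [orderAvg_mul_left, h2] at h1
  refine h1.trans ?_
  rw [inv_mul_eq_div, div_sub_one (by positivity)]
  gcongr
  nlinarith

end orderAvg

/-! ### The times at which given edges are presented -/

section times

variable {n : ℕ}

-- A permutation of the positions carrying `s` to `s'` acts on orders and maps one event bijectively
-- onto the other.
open Classical in
lemma card_filter_symm_eq {ι : Type*} [Fintype ι] (e : ι ↪ KEdge n)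
    (s s' : ι ↪ Fin (n.choose 2)) :
    (Finset.univ.filter fun σ : EdgeOrder n => e.trans σ.symm.toEmbedding = s).card =
      (Finset.univ.filter fun σ : EdgeOrder n => e.trans σ.symm.toEmbedding = s').card := by
  obtain ⟨π, hπ⟩ := Equiv.Perm.exists_extending_pair s s' s.injective s'.injective
  refine Finset.card_bij' (fun σ _ => π.symm.trans σ) (fun σ _ => π.trans σ) ?_ ?_ ?_ ?_
  · intro σ hσ
    simp only [Finset.mem_filter, Finset.mem_univ, true_and] at hσ ⊢
    ext1 i
    have : σ.symm (e i) = s i := by rw [← hσ]; rfl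
    change π (σ.symm (e i)) = s' i
    rw [this, hπ]
  · intro σ hσ
    simp only [Finset.mem_filter, Finset.mem_univ, true_and] at hσ ⊢
    ext1 i
    have : σ.symm (e i) = s' i := by rw [← hσ]; rfl
    change π.symm (σ.symm (e i)) = s i
    rw [this, ← hπ, Equiv.symm_apply_apply]
  · intro σ _; ext; simp
  · intro σ _; ext; simp

open Classical in
/-- The presentation times of distinct edges form a uniformly random injection. -/
lemma orderProb_times {ι : Type*} [Fintype ι] (e : ι ↪ KEdge n)
    (Q : (ι ↪ Fin (n.choose 2)) → Prop) :
    orderProb (fun σ => Q (e.trans σ.symm.toEmbedding)) =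
      ((Finset.univ.filter Q).card : ℝ) /
        ((n.choose 2).descFactorial (Fintype.card ι) : ℝ) := by
  set T : EdgeOrder n → (ι ↪ Fin (n.choose 2)) := fun σ => e.trans σ.symm.toEmbedding with hT
  obtain ⟨σ₀⟩ := EdgeOrder.instNonempty n
  set K := (Finset.univ.filter fun σ : EdgeOrder n => T σ = T σ₀).card with hK
  have hfib : ∀ s, (Finset.univ.filter fun σ : EdgeOrder n => T σ = s).card = K := fun s =>
    card_filter_symm_eq e s (T σ₀)
  have hKpos : 0 < K := Finset.card_pos.2 ⟨σ₀, by simp⟩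
  have hall : Fintype.card (EdgeOrder n) = (n.choose 2).descFactorial (Fintype.card ι) * K := by
    rw [← Finset.card_univ, Finset.card_eq_sum_card_fiberwise (f := T) (t := Finset.univ)
      (fun _ _ => Finset.mem_coe.2 (Finset.mem_univ _)), Finset.sum_congr rfl fun s _ => hfib s]
    simp [Fintype.card_embedding_eq]
  have hQ : (Finset.univ.filter fun σ => Q (T σ)).card = (Finset.univ.filter Q).card * K := by
    rw [Finset.card_eq_sum_card_fiberwise (f := T) (t := Finset.univ.filter Q)]
    · rw [Finset.sum_congr rfl (g := fun _ => K)]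
      · simp
      · intro s hs
        rw [← hfib s, Finset.filter_filter]
        congr 1
        ext σ
        simp only [Finset.mem_filter, Finset.mem_univ, true_and] at hs ⊢
        exact ⟨fun h => h.2, fun h => ⟨h ▸ hs, h⟩⟩
    · intro σ hσ
      simpa using hσ
  have hpos := card_edgeOrder_pos n
  rw [orderProb_eq_card_div, hQ, hall]
  push_cast
  rw [mul_div_mul_right _ _ (by exact_mod_cast hKpos.ne')]

lemma orderProb_forall_mem_le (S : Finset (KEdge n)) (J : KEdge n → Finset (Fin (n.choose 2))) :
    orderProb (fun σ => ∀ e ∈ S, σ.symm e ∈ J e) ≤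
      (∏ e ∈ S, ((J e).card : ℝ)) / ((n.choose 2).descFactorial S.card : ℝ) := by
  classical
  have h := orderProb_times (Function.Embedding.subtype fun e => e ∈ S)
    (fun s => ∀ e : {e // e ∈ S}, s e ∈ J e)
  have h' : orderProb (fun σ => ∀ e ∈ S, σ.symm e ∈ J e) = orderProb fun σ : EdgeOrder n =>
      ∀ e : {e // e ∈ S}, ((Function.Embedding.subtype fun e => e ∈ S).trans
        σ.symm.toEmbedding) e ∈ J e := by
    congr 1; funext σ; simp
  rw [h', h, Fintype.card_coe]
  refine div_le_div_of_nonneg_right ?_ (by positivity)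
  have : (Finset.univ.filter fun s : {e // e ∈ S} ↪ Fin (n.choose 2) => ∀ e : {e // e ∈ S}, s e ∈ J e).card ≤
      (Fintype.piFinset fun e : {e // e ∈ S} => J e).card := by
    refine Finset.card_le_card_of_injOn (fun s => (s : {e // e ∈ S} → Fin (n.choose 2))) ?_ ?_
    · intro s hs
      simpa using hs
    · exact fun s _ s' _ h => DFunLike.coe_injective h
  rw [Fintype.card_piFinset] at this
  have h2 : ∏ e : {e // e ∈ S}, (J e).card = ∏ e ∈ S, (J e).card :=
    Finset.prod_coe_sort S fun e => (J e).card
  rw [h2] at this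
  rw [← Nat.cast_prod, Nat.cast_le]
  convert this

lemma pow_le_descFactorial_cast {N r : ℕ} (h : r ≤ N + 1) :
    ((N : ℝ) + 1 - r) ^ r ≤ (N.descFactorial r : ℝ) := by
  have := Nat.pow_sub_le_descFactorial N r
  have h2 : (((N + 1 - r : ℕ) : ℝ)) ^ r ≤ (N.descFactorial r : ℝ) := by exact_mod_cast this
  rwa [Nat.cast_sub h, Nat.cast_add, Nat.cast_one] at h2

/-- The probability that given edges are all presented by time `t`. -/
lemma orderProb_forall_lt_le (S : Finset (KEdge n)) (t : ℕ) (h : 2 * S.card ≤ n.choose 2) :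
    orderProb (fun σ => ∀ e ∈ S, (σ.symm e).val < t) ≤
      (2 * t / (n.choose 2 : ℝ)) ^ S.card := by
  classical
  set N := n.choose 2 with hN
  rcases Nat.eq_zero_or_pos N with h0 | h0
  · have : S.card = 0 := by omega
    rw [this, pow_zero]
    exact orderProb_le_one _
  have hN0 : (0 : ℝ) < N := by exact_mod_cast h0
  have h1 := orderProb_forall_mem_le S fun _ => Finset.univ.filter fun i : Fin N => i.val < t
  simp only [Finset.mem_filter, Finset.mem_univ, true_and, Finset.prod_const] at h1
  refine h1.trans ?_
  have h2 : ((Finset.univ.filter fun i : Fin N => i.val < t).card : ℝ) ≤ t := by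
    have : (Finset.univ.filter fun i : Fin N => i.val < t).card ≤ (Finset.range t).card :=
      Finset.card_le_card_of_injOn (fun i => i.val) (fun i hi => by simpa using hi)
        (fun i _ j _ h => Fin.ext h)
    rw [Finset.card_range] at this
    exact_mod_cast this
  -- Since the set has at most N/2 edges, every factor of the falling factorial is at least N/2.
  have h3 : ((N : ℝ) / 2) ^ S.card ≤ (N.descFactorial S.card : ℝ) := by
    refine le_trans ?_ (pow_le_descFactorial_cast (by omega))
    have : (2 : ℝ) * S.card ≤ N := by exact_mod_cast h
    gcongr
    linarith
  calc _ ≤ (t : ℝ) ^ S.card / ((N : ℝ) / 2) ^ S.card := by gcongr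
    _ = _ := by rw [← div_pow, div_div_eq_mul_div, mul_comm (t : ℝ)]

end times

/-! ### The diamond probability -/

section probDiamond

variable {n t b : ℕ}

lemma map_uniform_toOuterMeasure (S : Strategy n t b) (A : Set (SimpleGraph (Fin n))) :
    (((PMF.uniformOfFintype (EdgeOrder n)).map fun σ => S.graphAt σ t).toOuterMeasure A) =
      ENNReal.ofReal (orderProb fun σ => S.graphAt σ t ∈ A) := by
  classical
  rw [PMF.toOuterMeasure_map_apply, PMF.toOuterMeasure_uniformOfFintype_apply,
    orderProb_eq_card_div, ENNReal.ofReal_div_of_pos (card_edgeOrder_pos n),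
    ENNReal.ofReal_natCast, ENNReal.ofReal_natCast]
  congr 2
  rw [Fintype.card_subtype]
  rfl

lemma probDiamond_pure (S : Strategy n t b) :
    RandomizedStrategy.probDiamond (PMF.pure S) =
      orderProb fun σ => diamond.IsContained (S.graphAt σ t) := by
  unfold RandomizedStrategy.probDiamond RandomizedStrategy.finalGraph
  rw [PMF.pure_bind, map_uniform_toOuterMeasure, ENNReal.toReal_ofReal (orderProb_nonneg _)]
  rfl

/-- The success probability of a randomized strategy is an average over deterministic ones, so
deterministic bounds suffice. -/
lemma probDiamond_le (B : RandomizedStrategy n t b) {q : ℝ}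
    (h : ∀ S : Strategy n t b, orderProb (fun σ => diamond.IsContained (S.graphAt σ t)) ≤ q) :
    B.probDiamond ≤ q := by
  unfold RandomizedStrategy.probDiamond RandomizedStrategy.finalGraph
  rw [PMF.toOuterMeasure_bind_apply]
  obtain ⟨S₀, -⟩ := B.support_nonempty
  refine ENNReal.toReal_le_of_le_ofReal ((orderProb_nonneg _).trans (h S₀)) ?_
  calc _ ≤ ∑' S, B S * ENNReal.ofReal q := by
        refine ENNReal.tsum_le_tsum fun S => ?_
        rw [map_uniform_toOuterMeasure]
        gcongr
        exact h S
    _ = _ := by rw [ENNReal.tsum_mul_right, B.tsum_coe, one_mul]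

lemma probDiamond_nonneg (B : RandomizedStrategy n t b) : 0 ≤ B.probDiamond :=
  ENNReal.toReal_nonneg

end probDiamond

/-! ### The next edge is uniform given the past -/

section next

variable {n : ℕ}

/-- A bounded number of configurations determined by the first `i` edges is completed by the next
edge with small probability. -/
lemma sub_mul_orderAvg_next_le {X : Type*} [DecidableEq X] (T : EdgeOrder n → Finset X)
    (ε : X → Sym2 (Fin n)) (i : Fin (n.choose 2))
    (hT : ∀ σ τ : EdgeOrder n, (∀ j < i, σ j = τ j) → T σ = T τ) :
    ((n.choose 2 : ℝ) - i) *
        orderAvg (fun σ => (((T σ).filter fun x => (σ i : Sym2 (Fin n)) = ε x).card : ℝ)) ≤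
      orderAvg fun σ => ((T σ).card : ℝ) := by
  set f : Fin (n.choose 2) → EdgeOrder n → ℝ := fun j σ =>
    (((T σ).filter fun x => (σ j : Sym2 (Fin n)) = ε x).card : ℝ) with hf
  -- Exchanging positions `i` and `j ≥ i` preserves the uniform law and leaves the first `i` edges,
  -- hence `T`, unchanged.
  have hswap : ∀ j ∈ Finset.Ici i, orderAvg (f i) = orderAvg (f j) := by
    intro j hj
    rw [Finset.mem_Ici] at hj
    unfold orderAvg
    congr 1
    refine Fintype.sum_equiv (Equiv.equivCongr (Equiv.swap i j) (Equiv.refl _)) _ _ fun σ => ?_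
    have h1 : T ((Equiv.equivCongr (Equiv.swap i j) (Equiv.refl _)) σ) = T σ := by
      refine hT _ _ fun l hl => ?_
      simp [Equiv.equivCongr, Equiv.swap_apply_of_ne_of_ne hl.ne (hl.trans_le hj).ne]
    have h2 : ((Equiv.equivCongr (Equiv.swap i j) (Equiv.refl _)) σ) j = σ i := by
      simp [Equiv.equivCongr]
    simp only [hf]
    rw [h1, h2]
  have h1 : ((n.choose 2 : ℝ) - i) * orderAvg (f i) = ∑ j ∈ Finset.Ici i, orderAvg (f j) := by
    rw [← Finset.sum_congr rfl hswap, Finset.sum_const, Fin.card_Ici, nsmul_eq_mul,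
      Nat.cast_sub i.isLt.le]
  rw [h1, ← orderAvg_sum]
  -- Over all positions from `i` on, a configuration is hit at most once, because its completing
  -- edge occupies only one position.
  refine orderAvg_mono fun σ => ?_
  simp only [hf]
  rw [← Nat.cast_sum, Nat.cast_le, ← Finset.card_biUnion]
  · exact Finset.card_le_card fun x hx => by
      simp only [Finset.mem_biUnion, Finset.mem_filter] at hx
      obtain ⟨_, _, h, _⟩ := hx
      exact h
  · intro j _ l _ hjl
    rw [Function.onFun, Finset.disjoint_left]
    intro x hx hx'
    simp only [Finset.mem_filter] at hx hx'
    exact hjl (σ.injective (Subtype.ext (hx.2.trans hx'.2.symm)))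

lemma orderAvg_next_le {X : Type*} [DecidableEq X] (T : EdgeOrder n → Finset X)
    (ε : X → Sym2 (Fin n)) (i : Fin (n.choose 2)) (hi : 2 * i.val ≤ n.choose 2)
    (hT : ∀ σ τ : EdgeOrder n, (∀ j < i, σ j = τ j) → T σ = T τ) :
    orderAvg (fun σ => (((T σ).filter fun x => (σ i : Sym2 (Fin n)) = ε x).card : ℝ)) ≤
      2 / (n.choose 2 : ℝ) * orderAvg fun σ => ((T σ).card : ℝ) := by
  have h := sub_mul_orderAvg_next_le T ε i hT
  have h0 : 0 ≤ orderAvg (fun σ => (((T σ).filter fun x => (σ i : Sym2 (Fin n)) = ε x).card : ℝ)) :=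
    orderAvg_nonneg fun _ => by positivity
  have hN : (0 : ℝ) < n.choose 2 := by exact_mod_cast (Nat.zero_le _).trans_lt i.isLt
  have hi' : (2 : ℝ) * i.val ≤ n.choose 2 := by exact_mod_cast hi
  rw [div_mul_eq_mul_div, le_div_iff₀ hN]
  nlinarith

end next

/-! ### Upper bounds on the diamond probability -/

section graphAt

variable {n t b : ℕ}

lemma Strategy.graphAt_adj (S : Strategy n t b) (σ : EdgeOrder n) (s : ℕ) (u v : Fin n) :
    (S.graphAt σ s).Adj u v ↔ ∃ i ∈ S.buys σ, i.val < s ∧ (σ i : Sym2 (Fin n)) = s(u, v) := by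
  unfold Strategy.graphAt
  rw [SimpleGraph.fromEdgeSet_adj, Set.mem_ofPred_eq]
  refine ⟨fun h => h.1, fun h => ⟨h, ?_⟩⟩
  rintro rfl
  obtain ⟨i, _, _, hi⟩ := h
  exact (σ i).2 (by rw [hi]; simp)

lemma Strategy.graphAt_congr (S : Strategy n t b) {σ τ : EdgeOrder n} {i : Fin (n.choose 2)}
    (h : ∀ j < i, σ j = τ j) : S.graphAt σ i = S.graphAt τ i := by
  ext u v
  rw [S.graphAt_adj, S.graphAt_adj]
  refine exists_congr fun j => ?_
  constructor
  · rintro ⟨h1, h2, h3⟩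
    exact ⟨(S.online σ τ j fun l hl => h l (hl.trans_lt h2)).1 h1, h2, by rw [← h j h2]; exact h3⟩
  · rintro ⟨h1, h2, h3⟩
    exact ⟨(S.online σ τ j fun l hl => h l (hl.trans_lt h2)).2 h1, h2, by rw [h j h2]; exact h3⟩

lemma Strategy.graphAt_mono (S : Strategy n t b) (σ : EdgeOrder n) {r s : ℕ} (h : r ≤ s) :
    S.graphAt σ r ≤ S.graphAt σ s := by
  intro u v
  rw [S.graphAt_adj, S.graphAt_adj]
  rintro ⟨i, h1, h2, h3⟩
  exact ⟨i, h1, h2.trans_le h, h3⟩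

open Classical in
/-- All degrees of `G` are at most `D`. -/
def DegreesLE (G : SimpleGraph (Fin n)) (D : ℕ) : Prop :=
  ∀ v, (Finset.univ.filter fun w => G.Adj v w).card ≤ D

lemma DegreesLE.anti {G H : SimpleGraph (Fin n)} {D : ℕ} (h : DegreesLE H D) (hGH : G ≤ H) :
    DegreesLE G D := by
  classical
  exact fun v => (Finset.card_le_card fun w hw => by
    simp only [Finset.mem_filter, Finset.mem_univ, true_and] at hw ⊢
    exact hGH hw).trans (h v)

/-- Distinct neighbours use distinct purchases. This gives the choice D = b. -/
lemma Strategy.degreesLE (S : Strategy n t b) (σ : EdgeOrder n) (s : ℕ) :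
    DegreesLE (S.graphAt σ s) b := by
  classical
  intro v
  rw [← Finset.card_image_of_injective _ (f := fun w => s(v, w)) fun w w' h => Sym2.congr_right.1 h]
  refine (Finset.card_le_card (t := (S.buys σ).image fun i => (σ i : Sym2 (Fin n)))
    fun e he => ?_).trans (Finset.card_image_le.trans (S.card_le σ))
  obtain ⟨w, hw, rfl⟩ := Finset.mem_image.1 he
  obtain ⟨i, h1, _, h3⟩ := (S.graphAt_adj σ s v w).1 (by simpa using hw)
  exact Finset.mem_image.2 ⟨i, h1, h3⟩

open Classical in
lemma Strategy.card_darts_le (S : Strategy n t b) (σ : EdgeOrder n) (s : ℕ) :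
    (Finset.univ.filter fun x : Fin n × Fin n => (S.graphAt σ s).Adj x.1 x.2).card ≤ 2 * b := by
  refine (Finset.card_le_mul_card_image_of_maps_to (f := fun x : Fin n × Fin n => s(x.1, x.2))
    (t := (S.buys σ).image fun i => (σ i : Sym2 (Fin n))) (fun x hx => ?_) 2 fun e _ => ?_).trans
    (Nat.mul_le_mul_left 2 (Finset.card_image_le.trans (S.card_le σ)))
  · obtain ⟨i, h1, _, h3⟩ := (S.graphAt_adj σ s _ _).1 (by simpa using hx)
    exact Finset.mem_image.2 ⟨i, h1, h3⟩
  · induction e with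
    | _ u v =>
      refine (Finset.card_le_card (t := {(u, v), (v, u)}) fun x hx => ?_).trans Finset.card_le_two
      have := (Finset.mem_filter.1 hx).2
      rw [Sym2.eq_iff] at this
      rcases this with ⟨rfl, rfl⟩ | ⟨rfl, rfl⟩ <;> simp

open Classical in
lemma Strategy.card_paths_two_le (S : Strategy n t b) (σ : EdgeOrder n) (s : ℕ) {D : ℕ}
    (hD : DegreesLE (S.graphAt σ s) D) :
    (Finset.univ.filter fun y : Fin 3 → Fin n => (S.graphAt σ s).Adj (y 0) (y 1) ∧
      (S.graphAt σ s).Adj (y 1) (y 2)).card ≤ D * (2 * b) := by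
  refine (Finset.card_le_mul_card_image_of_maps_to
    (f := fun y : Fin 3 → Fin n => (y 0, y 1)) (fun y hy => ?_) D fun e _ => ?_).trans
    (Nat.mul_le_mul_left D (S.card_darts_le σ s))
  · simp only [Finset.mem_filter, Finset.mem_univ, true_and] at hy ⊢
    exact hy.1
  · refine (Finset.card_le_card_of_injOn (fun y => y 2) (fun y hy => ?_) ?_).trans (hD e.2)
    · simp only [Finset.coe_filter, Finset.mem_filter, Finset.mem_univ, true_and,
        Set.mem_ofPred_eq] at hy ⊢
      rw [← hy.2]; exact hy.1.2
    · intro y hy z hz h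
      simp only [Finset.coe_filter, Finset.mem_filter, Finset.mem_univ, true_and,
        Set.mem_ofPred_eq] at hy hz h
      have h2 := hy.2.trans hz.2.symm
      simp only [Prod.mk.injEq] at h2
      funext k; fin_cases k
      exacts [h2.1, h2.2, h]

-- The middle edge is one of at most `2 * b` ordered purchased edges, and each end then extends in
-- at most `D` ways.
open Classical in
lemma Strategy.card_paths_three_le (S : Strategy n t b) (σ : EdgeOrder n) (s : ℕ) {D : ℕ}
    (hD : DegreesLE (S.graphAt σ s) D) :
    (Finset.univ.filter fun y : Fin 4 → Fin n => (S.graphAt σ s).Adj (y 0) (y 1) ∧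
      (S.graphAt σ s).Adj (y 1) (y 2) ∧ (S.graphAt σ s).Adj (y 2) (y 3)).card ≤
      D * D * (2 * b) := by
  refine (Finset.card_le_mul_card_image_of_maps_to
    (f := fun y : Fin 4 → Fin n => (y 1, y 2)) (fun y hy => ?_) (D * D) fun e _ => ?_).trans
    (Nat.mul_le_mul_left (D * D) (S.card_darts_le σ s))
  · simp only [Finset.mem_filter, Finset.mem_univ, true_and] at hy ⊢
    exact hy.2.1
  · refine (Finset.card_le_card_of_injOn (fun y => (y 0, y 3))
      (t := (Finset.univ.filter fun w => (S.graphAt σ s).Adj e.1 w) ×ˢ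
        (Finset.univ.filter fun w => (S.graphAt σ s).Adj e.2 w)) (fun y hy => ?_) ?_).trans
      ((Finset.card_product _ _).le.trans (Nat.mul_le_mul (hD e.1) (hD e.2)))
    · simp only [Finset.coe_filter, Finset.mem_filter, Finset.mem_univ, true_and,
        Set.mem_ofPred_eq, Finset.coe_product, Set.mem_prod] at hy ⊢
      rw [← hy.2]; exact ⟨hy.1.1.symm, hy.1.2.2⟩
    · intro y hy z hz h
      simp only [Finset.coe_filter, Finset.mem_filter, Finset.mem_univ, true_and,
        Set.mem_ofPred_eq] at hy hz
      have h2 := hy.2.trans hz.2.symm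
      simp only [Prod.mk.injEq] at h2 h
      funext k; fin_cases k
      exacts [h.1, h2.1, h2.2, h.2]

end graphAt

/-! ### Threats: configurations from which two further edges make a diamond -/

section threats

variable {n t b : ℕ}

/-- If configurations arise from a bounded number of precursors by the edge at time `i`, the edge
at a later time `j` completes one of them with small probability. -/
lemma orderProb_two_hits_le {X Y : Type*} [DecidableEq X] [DecidableEq Y]
    {i j : Fin (n.choose 2)} (hij : i < j) (hj : 2 * j.val ≤ n.choose 2)
    (T₁ : EdgeOrder n → Finset Y) (ε₁ : Y → Sym2 (Fin n))
    (T₂ : EdgeOrder n → Finset X) (ε₂ : X → Sym2 (Fin n))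
    (h₁ : ∀ σ τ : EdgeOrder n, (∀ l < i, σ l = τ l) → T₁ σ = T₁ τ)
    (h₂ : ∀ σ τ : EdgeOrder n, (∀ l < j, σ l = τ l) → T₂ σ = T₂ τ)
    {K₁ K₂ : ℕ} (hK₁ : ∀ σ, (T₁ σ).card ≤ K₁)
    (hK₂ : ∀ σ, (T₂ σ).card ≤ K₂ * ((T₁ σ).filter fun y => (σ i : Sym2 (Fin n)) = ε₁ y).card) :
    orderProb (fun σ => ∃ x ∈ T₂ σ, (σ j : Sym2 (Fin n)) = ε₂ x) ≤
      4 * (K₁ * K₂) / (n.choose 2 : ℝ) ^ 2 := by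
  have hN : (0 : ℝ) < n.choose 2 := by exact_mod_cast (Nat.zero_le _).trans_lt i.isLt
  calc _ ≤ orderAvg (fun σ =>
          (((T₂ σ).filter fun x => (σ j : Sym2 (Fin n)) = ε₂ x).card : ℝ)) := by
        refine orderProb_le_orderAvg (fun _ => by positivity) fun σ ⟨x, hx, hx'⟩ => ?_
        exact_mod_cast Finset.card_pos.2 ⟨x, Finset.mem_filter.2 ⟨hx, hx'⟩⟩
    _ ≤ 2 / (n.choose 2 : ℝ) * orderAvg fun σ => ((T₂ σ).card : ℝ) := orderAvg_next_le _ _ _ hj h₂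
    _ ≤ 2 / (n.choose 2 : ℝ) * (K₂ * orderAvg fun σ =>
          (((T₁ σ).filter fun y => (σ i : Sym2 (Fin n)) = ε₁ y).card : ℝ)) := by
        gcongr
        rw [← orderAvg_mul_left]
        exact orderAvg_mono fun σ => by exact_mod_cast hK₂ σ
    _ ≤ 2 / (n.choose 2 : ℝ) * (K₂ * (2 / (n.choose 2 : ℝ) * orderAvg fun σ =>
          ((T₁ σ).card : ℝ))) := by
        gcongr
        exact orderAvg_next_le _ _ _
          ((Nat.mul_le_mul_left 2 (Fin.lt_def.1 hij).le).trans hj) h₁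
    _ ≤ 2 / (n.choose 2 : ℝ) * (K₂ * (2 / (n.choose 2 : ℝ) * K₁)) := by
        gcongr
        rw [← orderAvg_const (n := n) (K₁ : ℝ)]
        exact orderAvg_mono fun σ => by exact_mod_cast hK₁ σ
    _ = _ := by field_simp; ring

/-- The edge at time `i` closes a four-cycle of Builder's graph, and the edge at time `j` is a
diagonal of it. -/
def Strategy.CycleThenDiagonal (S : Strategy n t b) (i j : Fin (n.choose 2))
    (σ : EdgeOrder n) : Prop :=
  ∃ y : Fin 4 → Fin n, ((S.graphAt σ i).Adj (y 0) (y 1) ∧ (S.graphAt σ i).Adj (y 1) (y 2) ∧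
    (S.graphAt σ i).Adj (y 2) (y 3)) ∧ (σ i : Sym2 (Fin n)) = s(y 0, y 3) ∧
    (σ j : Sym2 (Fin n)) = s(y 0, y 2)

/-- The edge at time `i` closes a triangle of Builder's graph, and the edge at time `j` joins the
vertex `k'` of it to a neighbour of the vertex `k`. -/
def Strategy.TriangleThenEar (S : Strategy n t b) (k k' : Fin 3) (i j : Fin (n.choose 2))
    (σ : EdgeOrder n) : Prop :=
  ∃ y : Fin 3 → Fin n, ((S.graphAt σ i).Adj (y 0) (y 1) ∧ (S.graphAt σ i).Adj (y 1) (y 2)) ∧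
    (σ i : Sym2 (Fin n)) = s(y 0, y 2) ∧ ∃ x, (S.graphAt σ j).Adj (y k) x ∧
    (σ j : Sym2 (Fin n)) = s(x, y k')

lemma Strategy.orderProb_cycleThenDiagonal_le (S : Strategy n t b) (D : ℕ)
    {i j : Fin (n.choose 2)} (hij : i < j) (hj : 2 * j.val ≤ n.choose 2) :
    orderProb (fun σ => DegreesLE (S.graphAt σ i) D ∧ S.CycleThenDiagonal i j σ) ≤
      8 * (b * D ^ 2) / (n.choose 2 : ℝ) ^ 2 := by
  classical
  -- Emptying the set when the degree bound fails makes its size bounded for every order, while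
  -- keeping it determined by the edges before `i`.
  set T : EdgeOrder n → Finset (Fin 4 → Fin n) := fun σ =>
    if DegreesLE (S.graphAt σ i) D then
      Finset.univ.filter fun y : Fin 4 → Fin n => (S.graphAt σ i).Adj (y 0) (y 1) ∧
        (S.graphAt σ i).Adj (y 1) (y 2) ∧ (S.graphAt σ i).Adj (y 2) (y 3)
    else ∅ with hT
  have hT₁ : ∀ σ τ : EdgeOrder n, (∀ l < i, σ l = τ l) → T σ = T τ := fun σ τ h => by
    simp only [hT, S.graphAt_congr h]
  have := orderProb_two_hits_le hij hj T (fun y => s(y 0, y 3))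
    (fun σ => (T σ).filter fun y => (σ i : Sym2 (Fin n)) = s(y 0, y 3)) (fun y => s(y 0, y 2))
    hT₁ (fun σ τ h => by
      rw [hT₁ σ τ fun l hl => h l (hl.trans hij), h i hij]) (K₁ := D * D * (2 * b)) (K₂ := 1)
    (fun σ => by
      simp only [hT]
      split_ifs with h
      · exact S.card_paths_three_le σ i h
      · simp) (fun σ => by simp)
  refine (orderProb_mono fun σ hσ => ?_).trans (this.trans (le_of_eq ?_))
  · obtain ⟨h, y, h1, h2, h3⟩ := hσ
    refine ⟨y, ?_, h3⟩
    simp only [hT, if_pos h, Finset.mem_filter, Finset.mem_univ, true_and]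
    exact ⟨h1, h2⟩
  · push_cast; ring

lemma Strategy.orderProb_triangleThenEar_le (S : Strategy n t b) (D : ℕ) (k k' : Fin 3)
    {i j : Fin (n.choose 2)} (hij : i < j) (hj : 2 * j.val ≤ n.choose 2) :
    orderProb (fun σ => DegreesLE (S.graphAt σ j) D ∧ S.TriangleThenEar k k' i j σ) ≤
      8 * (b * D ^ 2) / (n.choose 2 : ℝ) ^ 2 := by
  classical
  set T : EdgeOrder n → Finset (Fin 3 → Fin n) := fun σ =>
    if DegreesLE (S.graphAt σ i) D then
      Finset.univ.filter fun y : Fin 3 → Fin n => (S.graphAt σ i).Adj (y 0) (y 1) ∧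
        (S.graphAt σ i).Adj (y 1) (y 2)
    else ∅ with hT
  -- The pendant edge is read off the graph at time `j`, so it may have been bought before or after
  -- the triangle was closed; the degree bound at time `j` covers both.
  set T' : EdgeOrder n → Finset ((Fin 3 → Fin n) × Fin n) := fun σ =>
    if DegreesLE (S.graphAt σ j) D then
      (((T σ).filter fun y => (σ i : Sym2 (Fin n)) = s(y 0, y 2)) ×ˢ Finset.univ).filter
        fun x => (S.graphAt σ j).Adj (x.1 k) x.2
    else ∅ with hT'
  have hT₁ : ∀ σ τ : EdgeOrder n, (∀ l < i, σ l = τ l) → T σ = T τ := fun σ τ h => by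
    simp only [hT, S.graphAt_congr h]
  have := orderProb_two_hits_le hij hj T (fun y => s(y 0, y 2)) T'
    (fun x => s(x.2, x.1 k')) hT₁
    (fun σ τ h => by
      simp only [hT', S.graphAt_congr h]
      rw [hT₁ σ τ fun l hl => h l (hl.trans hij), h i hij]) (K₁ := D * (2 * b)) (K₂ := D)
    (fun σ => by
      simp only [hT]
      split_ifs with h
      · exact S.card_paths_two_le σ i h
      · simp) (fun σ => by
      simp only [hT']
      split_ifs with h
      · refine Finset.card_le_mul_card_image_of_maps_to (f := Prod.fst) (fun x hx => ?_) D
          fun y _ => ?_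
        · simp only [Finset.mem_filter, Finset.mem_product] at hx ⊢
          exact hx.1.1
        · refine (Finset.card_le_card_of_injOn Prod.snd (fun x hx => ?_) ?_).trans (h (y k))
          · simp only [Finset.coe_filter, Finset.mem_filter, Finset.mem_univ, true_and,
              Set.mem_ofPred_eq] at hx ⊢
            rw [← hx.2]; exact hx.1.2
          · intro x hx z hz hxz
            simp only [Finset.coe_filter, Set.mem_ofPred_eq] at hx hz
            exact Prod.ext (hx.2.trans hz.2.symm) hxz
      · simp)
  refine (orderProb_mono fun σ hσ => ?_).trans (this.trans (le_of_eq ?_))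
  · obtain ⟨h, y, h1, h2, x, h3, h4⟩ := hσ
    refine ⟨(y, x), ?_, h4⟩
    have h' : DegreesLE (S.graphAt σ i) D := h.anti (S.graphAt_mono σ (Fin.lt_def.1 hij).le)
    simp only [hT', hT, if_pos h, if_pos h', Finset.mem_filter, Finset.mem_product,
      Finset.mem_univ, true_and, and_true]
    exact ⟨⟨h1, h2⟩, h3⟩
  · push_cast; ring

/-- Whichever edge of the triangle on `a`, `b'`, `c` came last closed it over the other two. The
pendant edge is `ad`, and the final edge `b'd` joins its far end to the triangle vertex `b'`. -/
lemma Strategy.triangleThenEar_of_last (S : Strategy n t b) {σ : EdgeOrder n}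
    {a b' c d : Fin n} {iab iac ibc iad ibd : Fin (n.choose 2)}
    (mab : iab ∈ S.buys σ) (mac : iac ∈ S.buys σ) (mbc : ibc ∈ S.buys σ) (mad : iad ∈ S.buys σ)
    (eab : (σ iab : Sym2 (Fin n)) = s(a, b')) (eac : (σ iac : Sym2 (Fin n)) = s(a, c))
    (ebc : (σ ibc : Sym2 (Fin n)) = s(b', c)) (ead : (σ iad : Sym2 (Fin n)) = s(a, d))
    (ebd : (σ ibd : Sym2 (Fin n)) = s(b', d))
    (h1 : iab ≠ iac) (h2 : iab ≠ ibc) (h3 : iac ≠ ibc)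
    (hab : iab < ibd) (hac : iac < ibd) (hbc : ibc < ibd) (had : iad < ibd) :
    ∃ k k' i, i < ibd ∧ S.TriangleThenEar k k' i ibd σ := by
  have hd : (S.graphAt σ ibd).Adj a d := (S.graphAt_adj ..).2 ⟨iad, mad, had, ead⟩
  rcases lt_or_gt_of_ne h1 with h1 | h1 <;> rcases lt_or_gt_of_ne h2 with h2 | h2 <;>
    rcases lt_or_gt_of_ne h3 with h3 | h3
  case' inl.inl.inl => 
    refine ⟨1, 0, ibc, hbc, ![b', a, c], ⟨?_, ?_⟩, ebc, d, hd, ebd.trans Sym2.eq_swap⟩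
    · exact (S.graphAt_adj ..).2 ⟨iab, mab, h2, eab.trans Sym2.eq_swap⟩
    · exact (S.graphAt_adj ..).2 ⟨iac, mac, h3, eac⟩
  case' inr.inl.inl => 
    refine ⟨1, 0, ibc, hbc, ![b', a, c], ⟨?_, ?_⟩, ebc, d, hd, ebd.trans Sym2.eq_swap⟩
    · exact (S.graphAt_adj ..).2 ⟨iab, mab, h2, eab.trans Sym2.eq_swap⟩
    · exact (S.graphAt_adj ..).2 ⟨iac, mac, h3, eac⟩
  case' inl.inl.inr =>
    refine ⟨0, 1, iac, hac, ![a, b', c], ⟨?_, ?_⟩, eac, d, hd, ebd.trans Sym2.eq_swap⟩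
    · exact (S.graphAt_adj ..).2 ⟨iab, mab, h1, eab⟩
    · exact (S.graphAt_adj ..).2 ⟨ibc, mbc, h3, ebc⟩
  case' inl.inr.inr =>
    refine ⟨0, 1, iac, hac, ![a, b', c], ⟨?_, ?_⟩, eac, d, hd, ebd.trans Sym2.eq_swap⟩
    · exact (S.graphAt_adj ..).2 ⟨iab, mab, h1, eab⟩
    · exact (S.graphAt_adj ..).2 ⟨ibc, mbc, h3, ebc⟩
  case' inr.inr.inl =>
    refine ⟨0, 2, iab, hab, ![a, c, b'], ⟨?_, ?_⟩, eab, d, hd, ebd.trans Sym2.eq_swap⟩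
    · exact (S.graphAt_adj ..).2 ⟨iac, mac, h1, eac⟩
    · exact (S.graphAt_adj ..).2 ⟨ibc, mbc, h2, ebc.trans Sym2.eq_swap⟩
  case' inr.inr.inr =>
    refine ⟨0, 2, iab, hab, ![a, c, b'], ⟨?_, ?_⟩, eab, d, hd, ebd.trans Sym2.eq_swap⟩
    · exact (S.graphAt_adj ..).2 ⟨iac, mac, h1, eac⟩
    · exact (S.graphAt_adj ..).2 ⟨ibc, mbc, h2, ebc.trans Sym2.eq_swap⟩
  -- The two remaining sign patterns are cyclic comparisons, hence contradictory.
  all_goals order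

lemma Strategy.cycleThenDiagonal_of_last (S : Strategy n t b) {σ : EdgeOrder n}
    {a b' c d : Fin n} {iab iac ibc iad ibd : Fin (n.choose 2)}
    (mac : iac ∈ S.buys σ) (mad : iad ∈ S.buys σ) (mbd : ibd ∈ S.buys σ)
    (eab : (σ iab : Sym2 (Fin n)) = s(a, b')) (eac : (σ iac : Sym2 (Fin n)) = s(a, c))
    (ebc : (σ ibc : Sym2 (Fin n)) = s(b', c)) (ead : (σ iad : Sym2 (Fin n)) = s(a, d))
    (ebd : (σ ibd : Sym2 (Fin n)) = s(b', d))
    (h1 : iac < ibc) (h2 : iad < ibc) (h3 : ibd < ibc) :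
    S.CycleThenDiagonal ibc iab σ := by
  refine ⟨![b', d, a, c], ⟨?_, ?_, ?_⟩, ebc, eab.trans Sym2.eq_swap⟩
  · exact (S.graphAt_adj ..).2 ⟨ibd, mbd, h3, ebd⟩
  · exact (S.graphAt_adj ..).2 ⟨iad, mad, h2, ead.trans Sym2.eq_swap⟩
  · exact (S.graphAt_adj ..).2 ⟨iac, mac, h1, eac⟩

/-- Split by the last of the five edges. If it is the spine, the latest of the four outer edges
closes the four-cycle; otherwise the triangle avoiding the last edge was already complete.
Symmetries of the diamond reduce the cases to the two preceding lemmas. -/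
lemma Strategy.exists_threat_of_diamond (S : Strategy n t b) {σ : EdgeOrder n}
    (h : diamond.IsContained (S.graphAt σ t)) :
    ∃ i j : Fin (n.choose 2), i < j ∧ j.val < t ∧
      (S.CycleThenDiagonal i j σ ∨ ∃ k k', S.TriangleThenEar k k' i j σ) := by
  obtain ⟨f⟩ := h
  have hadj : ∀ u v : Fin 4, diamond.Adj u v →
      ∃ i ∈ S.buys σ, i.val < t ∧ (σ i : Sym2 (Fin n)) = s(f u, f v) := fun u v huv =>
    (S.graphAt_adj σ t _ _).1 (f.toHom.map_adj huv)
  have hinj : ∀ u v : Fin 4, u ≠ v → f u ≠ f v := fun u v huv h => huv (f.injective h)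
  obtain ⟨ac, mac, tac, eac⟩ := hadj 2 0 (by simp [diamond])
  obtain ⟨bc, mbc, tbc, ebc⟩ := hadj 3 0 (by simp [diamond])
  obtain ⟨ad, mad, tad, ead⟩ := hadj 2 1 (by simp [diamond])
  obtain ⟨bd, mbd, tbd, ebd⟩ := hadj 3 1 (by simp [diamond])
  obtain ⟨ab, mab, tab, eab⟩ := hadj 2 3 (by simp [diamond])
  have n01 := hinj 0 1 (by decide)
  have n02 := hinj 0 2 (by decide)
  have n03 := hinj 0 3 (by decide)
  have n12 := hinj 1 2 (by decide)
  have n13 := hinj 1 3 (by decide)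
  have n23 := hinj 2 3 (by decide)
  generalize f 0 = c at *
  generalize f 1 = d at *
  generalize f 2 = a at *
  generalize f 3 = b' at *
  have key : ∀ {i j : Fin (n.choose 2)} {e e' : Sym2 (Fin n)}, (σ i : Sym2 (Fin n)) = e →
      (σ j : Sym2 (Fin n)) = e' → e ≠ e' → i ≠ j := by
    rintro i j e e' hi hj hne rfl
    exact hne (hi.symm.trans hj)
  have d1 : ac ≠ bc := key eac ebc (by simp; tauto)
  have d2 : ac ≠ ad := key eac ead (by simp; tauto)
  have d3 : ac ≠ bd := key eac ebd (by simp; tauto)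
  have d4 : ac ≠ ab := key eac eab (by simp; tauto)
  have d5 : bc ≠ ad := key ebc ead (by simp; tauto)
  have d6 : bc ≠ bd := key ebc ebd (by simp; tauto)
  have d7 : bc ≠ ab := key ebc eab (by simp; tauto)
  have d8 : ad ≠ bd := key ead ebd (by simp; tauto)
  have d9 : ad ≠ ab := key ead eab (by simp; tauto)
  have d10 : bd ≠ ab := key ebd eab (by simp; tauto)
  have eba := eab.trans Sym2.eq_swap
  have hmax : (ac < ab ∧ bc < ab ∧ ad < ab ∧ bd < ab) ∨ (ab < ac ∧ bc < ac ∧ ad < ac ∧ bd < ac) ∨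
      (ab < bc ∧ ac < bc ∧ ad < bc ∧ bd < bc) ∨ (ab < ad ∧ ac < ad ∧ bc < ad ∧ bd < ad) ∨
      (ab < bd ∧ ac < bd ∧ bc < bd ∧ ad < bd) := by
    omega
  rcases hmax with ⟨g1, g2, g3, g4⟩ | ⟨g1, g2, g3, g4⟩ | ⟨g1, g2, g3, g4⟩ | ⟨g1, g2, g3, g4⟩ |
    ⟨g1, g2, g3, g4⟩
  · have hmax' : (bc < ac ∧ ad < ac ∧ bd < ac) ∨ (ac < bc ∧ ad < bc ∧ bd < bc) ∨
        (ac < ad ∧ bc < ad ∧ bd < ad) ∨ (ac < bd ∧ bc < bd ∧ ad < bd) := by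
      omega
    rcases hmax' with ⟨h1, h2, h3⟩ | ⟨h1, h2, h3⟩ | ⟨h1, h2, h3⟩ | ⟨h1, h2, h3⟩
    · exact ⟨ac, ab, g1, tab, Or.inl (S.cycleThenDiagonal_of_last mbc mbd mad eba ebc eac ebd ead
        h1 h3 h2)⟩
    · exact ⟨bc, ab, g2, tab, Or.inl (S.cycleThenDiagonal_of_last mac mad mbd eab eac ebc ead ebd
        h1 h2 h3)⟩
    · exact ⟨ad, ab, g3, tab, Or.inl (S.cycleThenDiagonal_of_last mbd mbc mac eba ebd ead ebc eac
        h3 h2 h1)⟩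
    · exact ⟨bd, ab, g4, tab, Or.inl (S.cycleThenDiagonal_of_last mad mac mbc eab ead ebd eac ebc
        h3 h1 h2)⟩
  · obtain ⟨k, k', i, hi, h⟩ := S.triangleThenEar_of_last mab mbd mad mbc eba ebd ead ebc eac
      d10.symm d9.symm d8.symm g1 g4 g3 g2
    exact ⟨i, ac, hi, tac, Or.inr ⟨k, k', h⟩⟩
  · obtain ⟨k, k', i, hi, h⟩ := S.triangleThenEar_of_last mab mad mbd mac eab ead ebd eac ebc
      d9.symm d10.symm d8 g1 g3 g4 g2
    exact ⟨i, bc, hi, tbc, Or.inr ⟨k, k', h⟩⟩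
  · obtain ⟨k, k', i, hi, h⟩ := S.triangleThenEar_of_last mab mbc mac mbd eba ebc eac ebd ead
      d7.symm d4.symm d1.symm g1 g3 g2 g4
    exact ⟨i, ad, hi, tad, Or.inr ⟨k, k', h⟩⟩
  · obtain ⟨k, k', i, hi, h⟩ := S.triangleThenEar_of_last mab mac mbc mad eab eac ebc ead ebd
      d4.symm d7.symm d1 g1 g2 g3 g4
    exact ⟨i, bd, hi, tbd, Or.inr ⟨k, k', h⟩⟩

/-- The main upper bound: `D` is any bound on the degrees of Builder's graph. -/
lemma Strategy.orderProb_diamond_le (S : Strategy n t b) (D : ℕ) (ht : 2 * t ≤ n.choose 2) :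
    orderProb (fun σ => diamond.IsContained (S.graphAt σ t)) ≤
      orderProb (fun σ => ¬ DegreesLE (S.graphAt σ t) D) +
        80 * (b * D ^ 2) * (t / (n.choose 2 : ℝ)) ^ 2 := by
  classical
  set I := Finset.univ.filter fun i : Fin (n.choose 2) => i.val < t with hI
  have hcard : (I.card : ℝ) ≤ t := by
    have : I.card ≤ (Finset.range t).card :=
      Finset.card_le_card_of_injOn (fun i => i.val) (fun i hi => by simpa [hI] using hi)
        (fun i _ j _ h => Fin.ext h)
    rw [Finset.card_range] at this
    exact_mod_cast this
  set c : ℝ := 8 * (b * D ^ 2) / (n.choose 2 : ℝ) ^ 2 with hc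
  have hc0 : 0 ≤ c := by positivity
  have h1 : orderProb (fun σ => diamond.IsContained (S.graphAt σ t)) ≤
      orderProb (fun σ => ¬ DegreesLE (S.graphAt σ t) D ∨ ∃ x ∈ I ×ˢ I, x.1 < x.2 ∧
        ((DegreesLE (S.graphAt σ x.1) D ∧ S.CycleThenDiagonal x.1 x.2 σ) ∨
          ∃ q ∈ (Finset.univ : Finset (Fin 3 × Fin 3)),
            DegreesLE (S.graphAt σ x.2) D ∧ S.TriangleThenEar q.1 q.2 x.1 x.2 σ)) := by
    refine orderProb_mono fun σ hσ => ?_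
    by_cases hD : DegreesLE (S.graphAt σ t) D
    · right
      obtain ⟨i, j, hij, hj, h⟩ := S.exists_threat_of_diamond hσ
      have hi : i.val < t := (Fin.lt_def.1 hij).trans hj
      refine ⟨(i, j), by simp [hI, hi, hj], hij, ?_⟩
      rcases h with h | ⟨k, k', h⟩
      · exact Or.inl ⟨hD.anti (S.graphAt_mono σ hi.le), h⟩
      · exact Or.inr ⟨(k, k'), Finset.mem_univ _, hD.anti (S.graphAt_mono σ hj.le), h⟩
    · exact Or.inl hD
  refine h1.trans ((orderProb_or_le _ _).trans (add_le_add le_rfl ?_))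
  refine (orderProb_exists_le _ _).trans ?_
  -- Each pair of times carries ten threats: one four-cycle threat and nine choices of the two
  -- triangle vertices `k`, `k'`.
  calc _ ≤ ∑ x ∈ I ×ˢ I, (10 * c) := by
        refine Finset.sum_le_sum fun x hx => ?_
        by_cases hlt : x.1 < x.2
        · have hx2 : 2 * x.2.val ≤ n.choose 2 := by
            have : x.2.val < t := by simpa [hI] using (Finset.mem_product.1 hx).2
            omega
          calc _ ≤ _ := orderProb_mono (Q := fun σ => _ ∨ _) fun σ hσ => hσ.2
            _ ≤ _ := orderProb_or_le _ _
            _ ≤ c + ∑ q : Fin 3 × Fin 3, c := by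
              refine add_le_add (S.orderProb_cycleThenDiagonal_le D hlt hx2) ?_
              exact (orderProb_exists_le _ _).trans (Finset.sum_le_sum fun q _ =>
                S.orderProb_triangleThenEar_le D q.1 q.2 hlt hx2)
            _ = 10 * c := by simp; ring
        · refine le_trans (le_of_eq ?_) (by positivity : 0 ≤ 10 * c)
          simp [hlt, orderProb, orderAvg]
    _ = I.card ^ 2 * (10 * c) := by
        rw [Finset.sum_const, Finset.card_product, nsmul_eq_mul]; push_cast; ring
    _ ≤ t ^ 2 * (10 * c) := by gcongr
    _ = _ := by rw [hc, div_pow]; ring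

/-- The first moment bound. -/
lemma Strategy.orderProb_diamond_le_first_moment (S : Strategy n t b) (hn : 10 ≤ n.choose 2) :
    orderProb (fun σ => diamond.IsContained (S.graphAt σ t)) ≤
      (n : ℝ) ^ 4 * (2 * t / (n.choose 2 : ℝ)) ^ 5 := by
  classical
  set E : Finset (Sym2 (Fin 4)) := {s(2, 3), s(2, 0), s(2, 1), s(3, 0), s(3, 1)} with hE
  set F : (Fin 4 → Fin n) → Finset (KEdge n) := fun y =>
    (E.image fun e => e.map y).subtype _ with hF
  have h1 : orderProb (fun σ => diamond.IsContained (S.graphAt σ t)) ≤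
      orderProb (fun σ => ∃ y ∈ Finset.univ.filter fun y : Fin 4 → Fin n => Function.Injective y,
        ∀ e ∈ F y, (σ.symm e).val < t) := by
    refine orderProb_mono fun σ ⟨f⟩ => ⟨f, by simpa using f.injective, fun e he => ?_⟩
    rw [hF, Finset.mem_subtype, Finset.mem_image] at he
    obtain ⟨e', he', heq⟩ := he
    have hadj : e' ∈ diamond.edgeSet := by
      revert he'
      simp only [hE, Finset.mem_insert, Finset.mem_singleton]
      rintro (rfl | rfl | rfl | rfl | rfl) <;> simp [diamond]
    induction e' with
    | _ u v =>
      obtain ⟨i, _, hi, hi'⟩ := (S.graphAt_adj σ t _ _).1 (f.toHom.map_adj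
        ((SimpleGraph.mem_edgeSet _).1 hadj))
      have : σ i = e := Subtype.ext (hi'.trans heq)
      rw [← this, Equiv.symm_apply_apply]
      exact hi
  refine h1.trans ((orderProb_exists_le _ _).trans ?_)
  calc _ ≤ ∑ y ∈ Finset.univ.filter fun y : Fin 4 → Fin n => Function.Injective y,
        (2 * t / (n.choose 2 : ℝ)) ^ 5 := by
        refine Finset.sum_le_sum fun y hy => ?_
        have hinj : Function.Injective y := by simpa using hy
        have hFc : (F y).card = 5 := by
          rw [hF, Finset.card_subtype, Finset.filter_true_of_mem,
            Finset.card_image_of_injective _ (Sym2.map.injective hinj)]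
          · decide
          · intro e he
            obtain ⟨e', he', rfl⟩ := Finset.mem_image.1 he
            rw [Sym2.isDiag_map hinj]
            exact (by decide : ∀ e ∈ E, ¬ e.IsDiag) e' he'
        have := orderProb_forall_lt_le (F y) t (by rw [hFc]; exact hn)
        rwa [hFc] at this
    _ ≤ ∑ y : Fin 4 → Fin n, (2 * t / (n.choose 2 : ℝ)) ^ 5 :=
        Finset.sum_le_sum_of_subset_of_nonneg (Finset.filter_subset _ _)
          fun _ _ _ => by positivity
    _ = _ := by simp

/-- A tail bound for the maximum degree. -/
lemma Strategy.orderProb_not_degreesLE_le (S : Strategy n t b) (D : ℕ)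
    (hD : 2 * (D + 1) ≤ n.choose 2) :
    orderProb (fun σ => ¬ DegreesLE (S.graphAt σ t) D) ≤
      n * ((n * (2 * t / (n.choose 2 : ℝ))) ^ (D + 1) / (D + 1).factorial) := by
  classical
  set star : Fin n → Finset (Fin n) → Finset (KEdge n) := fun v R =>
    (R.image fun w => s(v, w)).subtype _ with hstar
  set Rs : Fin n → Finset (Finset (Fin n)) := fun v => Finset.powersetCard (D + 1) {v}ᶜ with hRs
  -- A vertex of degree above `D` is the centre of a star with `D + 1` edges, all presented by time
  -- `t`; a union bound over stars follows.
  have h1 : orderProb (fun σ => ¬ DegreesLE (S.graphAt σ t) D) ≤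
      orderProb (fun σ => ∃ v ∈ (Finset.univ : Finset (Fin n)), ∃ R ∈ Rs v,
        ∀ e ∈ star v R, (σ.symm e).val < t) := by
    refine orderProb_mono fun σ hσ => ?_
    unfold DegreesLE at hσ
    push Not at hσ
    obtain ⟨v, hv⟩ := hσ
    obtain ⟨R, hR, hRc⟩ := Finset.exists_subset_card_eq hv
    refine ⟨v, Finset.mem_univ _, R, ?_, fun e he => ?_⟩
    · rw [hRs, Finset.mem_powersetCard]
      refine ⟨fun w hw => ?_, hRc⟩
      have := (Finset.mem_filter.1 (hR hw)).2
      simpa using this.ne'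
    · rw [hstar, Finset.mem_subtype, Finset.mem_image] at he
      obtain ⟨w, hw, heq⟩ := he
      obtain ⟨i, _, hi, hi'⟩ := (S.graphAt_adj σ t _ _).1 (Finset.mem_filter.1 (hR hw)).2
      have : σ i = e := Subtype.ext (hi'.trans heq)
      rw [← this, Equiv.symm_apply_apply]
      exact hi
  have hstar_card : ∀ v, ∀ R ∈ Rs v, (star v R).card = D + 1 := by
    intro v R hR
    rw [hRs, Finset.mem_powersetCard] at hR
    rw [hstar, Finset.card_subtype, Finset.filter_true_of_mem, Finset.card_image_of_injective, hR.2]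
    · exact fun w w' h => Sym2.congr_right.1 h
    · intro e he
      obtain ⟨w, hw, rfl⟩ := Finset.mem_image.1 he
      have := hR.1 hw
      simp only [Finset.mem_compl, Finset.mem_singleton] at this
      simpa using Ne.symm this
  refine h1.trans ((orderProb_exists_le _ _).trans ?_)
  calc _ ≤ ∑ v : Fin n, ∑ R ∈ Rs v, (2 * t / (n.choose 2 : ℝ)) ^ (D + 1) := by
        refine Finset.sum_le_sum fun v _ => (orderProb_exists_le _ _).trans ?_
        refine Finset.sum_le_sum fun R hR => ?_
        have := orderProb_forall_lt_le (star v R) t (by rw [hstar_card v R hR]; exact hD)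
        rwa [hstar_card v R hR] at this
    _ ≤ ∑ v : Fin n, (n : ℝ) ^ (D + 1) / (D + 1).factorial *
          (2 * t / (n.choose 2 : ℝ)) ^ (D + 1) := by
        refine Finset.sum_le_sum fun v _ => ?_
        rw [Finset.sum_const, nsmul_eq_mul]
        gcongr
        rw [hRs, Finset.card_powersetCard]
        refine (Nat.choose_le_pow_div (D + 1) _).trans ?_
        gcongr
        exact_mod_cast (Finset.card_le_univ _).trans (by simp)
    _ = _ := by
        rw [Finset.sum_const, nsmul_eq_mul, Finset.card_univ, Fintype.card_fin, mul_pow]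
        ring

end threats

/-! ### Asymptotics of the upper bound -/

section upper

variable {n t b : ℕ}

lemma sq_div_four_le_choose_two (hn : 2 ≤ n) : (n : ℝ) ^ 2 / 4 ≤ (n.choose 2 : ℝ) := by
  rw [Nat.cast_choose_two]
  have : (2 : ℝ) ≤ n := by exact_mod_cast hn
  nlinarith

lemma choose_two_le_sq_div_two : (n.choose 2 : ℝ) ≤ (n : ℝ) ^ 2 / 2 := by
  rw [Nat.cast_choose_two]
  nlinarith [(Nat.cast_nonneg n : (0 : ℝ) ≤ n)]

lemma Strategy.orderProb_diamond_le_of_time (S : Strategy n t b) (hn : 7 ≤ n) :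
    orderProb (fun σ => diamond.IsContained (S.graphAt σ t)) ≤
      8 ^ 5 * ((t : ℝ) / (n : ℝ) ^ (6 / 5 : ℝ)) ^ 5 := by
  have hn' : (7 : ℝ) ≤ n := by exact_mod_cast hn
  have hN := sq_div_four_le_choose_two (n := n) (by omega)
  have h10 : 10 ≤ n.choose 2 := by
    have : (10 : ℝ) ≤ n.choose 2 := by nlinarith
    exact_mod_cast this
  refine (S.orderProb_diamond_le_first_moment h10).trans ?_
  have hpow : ((n : ℝ) ^ (6 / 5 : ℝ)) ^ 5 = (n : ℝ) ^ 6 := by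
    rw [← Real.rpow_mul_natCast (by positivity), ← Real.rpow_natCast]; norm_num
  rw [div_pow (t : ℝ), hpow]
  calc _ ≤ (n : ℝ) ^ 4 * (2 * t / ((n : ℝ) ^ 2 / 4)) ^ 5 := by gcongr
    _ = _ := by field_simp; ring

lemma Strategy.orderProb_diamond_eq_zero (S : Strategy n t 0) :
    orderProb (fun σ => diamond.IsContained (S.graphAt σ t)) = 0 := by
  have : ∀ σ, ¬ diamond.IsContained (S.graphAt σ t) := by
    rintro σ ⟨f⟩
    have hadj : diamond.Adj 2 0 := by simp [diamond]
    obtain ⟨i, hi, _⟩ := (S.graphAt_adj σ t _ _).1 (f.toHom.map_adj hadj)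
    have := S.card_le σ
    rw [Nat.le_zero, Finset.card_eq_zero] at this
    simp [this] at hi
  simp [this, orderProb, orderAvg]

/-- Here t is at least n²/8, so the threshold is bounded (4096 = 8⁴). A budget far below it must
then be zero, which disposes of the late times excluded by the hypothesis `2 * t ≤ n.choose 2`
elsewhere. -/
lemma budgetThreshold_le_of_late (hn : 2 ≤ n) (ht : n.choose 2 < 2 * t) :
    budgetThreshold n t ≤ 4096 := by
  have hN := sq_div_four_le_choose_two hn
  have hn' : (2 : ℝ) ≤ n := by exact_mod_cast hn
  have ht' : (n.choose 2 : ℝ) < 2 * t := by exact_mod_cast ht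
  have h8 : (n : ℝ) ^ 2 ≤ 8 * t := by linarith
  have htpos : (0 : ℝ) < t := by nlinarith
  refine max_le ?_ ?_
  · rw [div_le_iff₀ (by positivity)]
    calc (n : ℝ) ^ 6 ≤ (n : ℝ) ^ 8 := pow_le_pow_right₀ (by linarith) (by norm_num)
      _ = ((n : ℝ) ^ 2) ^ 4 := by ring
      _ ≤ (8 * t) ^ 4 := by gcongr
      _ = _ := by ring
  · rw [div_le_iff₀ (by positivity)]
    calc (n : ℝ) ^ (4 / 3 : ℝ) = ((n : ℝ) ^ 2) ^ (2 / 3 : ℝ) := by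
          rw [← Real.rpow_natCast_mul (by positivity)]; norm_num
      _ ≤ (8 * t) ^ (2 / 3 : ℝ) := by gcongr
      _ = 8 ^ (2 / 3 : ℝ) * (t : ℝ) ^ (2 / 3 : ℝ) := by
          rw [Real.mul_rpow (by norm_num) (by positivity)]
      _ ≤ 4096 * (t : ℝ) ^ (2 / 3 : ℝ) := by
          gcongr
          calc (8 : ℝ) ^ (2 / 3 : ℝ) ≤ 8 ^ (1 : ℝ) :=
                Real.rpow_le_rpow_of_exponent_le (by norm_num) (by norm_num)
            _ ≤ 4096 := by norm_num

/-- Since m^m / m! ≤ e^m, the ratio is at most (e/6)^m, and e < 3. -/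
lemma pow_div_factorial_le_half_pow {x : ℝ} (hx : 0 ≤ x) {m : ℕ} (h : 6 * x ≤ m) :
    x ^ m / m.factorial ≤ (1 / 2) ^ m := by
  have h1 : (m : ℝ) ^ m / m.factorial ≤ Real.exp m :=
    Real.pow_div_factorial_le_exp m (by positivity) m
  calc x ^ m / m.factorial ≤ (m / 6) ^ m / m.factorial := by gcongr; linarith
    _ = (1 / 6) ^ m * ((m : ℝ) ^ m / m.factorial) := by rw [div_pow, div_pow, one_pow]; ring
    _ ≤ (1 / 6) ^ m * Real.exp m := by gcongr
    _ = (1 / 6 * Real.exp 1) ^ m := by rw [mul_pow, ← Real.exp_nat_mul, mul_one]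
    _ ≤ (1 / 2) ^ m := by
        gcongr
        linarith [Real.exp_one_lt_d9]

/-- This is the bound with D = b, where the degree condition never fails. -/
lemma Strategy.orderProb_diamond_le_star (S : Strategy n t b) (ht : 2 * t ≤ n.choose 2)
    (hn : 2 ≤ n) :
    orderProb (fun σ => diamond.IsContained (S.graphAt σ t)) ≤
      1280 * ((b : ℝ) / ((n : ℝ) ^ (4 / 3 : ℝ) / (t : ℝ) ^ (2 / 3 : ℝ))) ^ 3 := by
  have hN := sq_div_four_le_choose_two hn
  have hn' : (2 : ℝ) ≤ n := by exact_mod_cast hn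
  refine (S.orderProb_diamond_le b ht).trans ?_
  have h0 : orderProb (fun σ => ¬ DegreesLE (S.graphAt σ t) b) = 0 := by
    simp [S.degreesLE, orderProb, orderAvg]
  rw [h0, zero_add]
  have h1 : ((n : ℝ) ^ (4 / 3 : ℝ)) ^ 3 = (n : ℝ) ^ 4 := by
    rw [← Real.rpow_mul_natCast (by positivity), ← Real.rpow_natCast]; norm_num
  have h2 : ((t : ℝ) ^ (2 / 3 : ℝ)) ^ 3 = (t : ℝ) ^ 2 := by
    rw [← Real.rpow_mul_natCast (by positivity), ← Real.rpow_natCast]; norm_num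
  rw [div_pow _ _ 3, div_pow _ _ 3, h1, h2]
  calc _ ≤ 80 * (b * (b : ℝ) ^ 2) * (t / ((n : ℝ) ^ 2 / 4)) ^ 2 := by gcongr
    _ = _ := by field_simp; ring

lemma Strategy.orderProb_diamond_le_sparse (S : Strategy n t b) (ht : 2 * t ≤ n.choose 2)
    (hn : 100 ≤ n) (hnt : (n : ℝ) ^ (11 / 10 : ℝ) ≤ t) :
    orderProb (fun σ => diamond.IsContained (S.graphAt σ t)) ≤
      n * (1 / 2 : ℝ) ^ ((n : ℝ) ^ (1 / 10 : ℝ)) +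
        3073280 * ((b : ℝ) / ((n : ℝ) ^ 6 / (t : ℝ) ^ 4)) := by
  have hN := sq_div_four_le_choose_two (n := n) (by omega)
  have hN2 := choose_two_le_sq_div_two (n := n)
  have hn' : (100 : ℝ) ≤ n := by exact_mod_cast hn
  have ht' : (2 : ℝ) * t ≤ n.choose 2 := by exact_mod_cast ht
  have hrn : (n : ℝ) * (n : ℝ) ^ (1 / 10 : ℝ) ≤ t := by
    refine le_trans (le_of_eq ?_) hnt
    rw [← Real.rpow_one_add' (by positivity) (by norm_num)]; norm_num
  have hone : (1 : ℝ) ≤ (n : ℝ) ^ (1 / 10 : ℝ) := Real.one_le_rpow (by linarith) (by norm_num)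
  have hrt : (n : ℝ) ^ (1 / 10 : ℝ) ≤ t / n := by
    rw [le_div_iff₀ (by positivity)]; linarith
  -- The tail bound has base n · 2t/N ≤ 8t/n, and `pow_div_factorial_le_half_pow` asks for six times
  -- that. As t/n ≥ 1, rounding up costs at most one more multiple of t/n, whence 49 below.
  set D := ⌈48 * (t : ℝ) / n⌉₊ with hD
  have hD1 : 48 * (t : ℝ) / n ≤ D := Nat.le_ceil _
  have hD2 : (D : ℝ) < 48 * (t : ℝ) / n + 1 := Nat.ceil_lt_add_one (by positivity)
  rw [mul_div_assoc] at hD1 hD2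
  have htn : (t : ℝ) / n ≤ n / 4 := by
    rw [div_le_iff₀ (by positivity)]; nlinarith
  have hDN : 2 * (D + 1) ≤ n.choose 2 := by
    have : (2 : ℝ) * (D + 1) ≤ n.choose 2 := by nlinarith
    exact_mod_cast this
  refine (S.orderProb_diamond_le D ht).trans (add_le_add ?_ ?_)
  · refine (S.orderProb_not_degreesLE_le D hDN).trans ?_
    gcongr
    have h1 : (n : ℝ) * (2 * t / (n.choose 2 : ℝ)) ≤ 8 * (t / n) := by
      calc _ ≤ (n : ℝ) * (2 * t / ((n : ℝ) ^ 2 / 4)) := by gcongr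
        _ = _ := by field_simp; ring
    refine (pow_div_factorial_le_half_pow (by positivity) ?_).trans ?_
    · push_cast; linarith
    · rw [← Real.rpow_natCast]
      refine Real.rpow_le_rpow_of_exponent_ge (by norm_num) (by norm_num) ?_
      push_cast
      have : (0 : ℝ) ≤ t / n := by positivity
      linarith
  · have hD3 : (D : ℝ) ≤ 49 * (t / n) := by linarith
    calc _ ≤ 80 * (b * (49 * ((t : ℝ) / n)) ^ 2) * (t / ((n : ℝ) ^ 2 / 4)) ^ 2 := by gcongr
      _ = _ := by field_simp; ring

/-- With x = n^(1/10) the expression is x^10 · exp(-x log 2). -/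
lemma tendsto_mul_half_rpow :
    Tendsto (fun n : ℕ => (n : ℝ) * (1 / 2 : ℝ) ^ ((n : ℝ) ^ (1 / 10 : ℝ))) atTop (𝓝 0) := by
  have h := tendsto_rpow_mul_exp_neg_mul_atTop_nhds_zero 10 (Real.log 2)
    (Real.log_pos (by norm_num))
  have h2 : Tendsto (fun n : ℕ => (n : ℝ) ^ (1 / 10 : ℝ)) atTop atTop :=
    (tendsto_rpow_atTop (by norm_num)).comp tendsto_natCast_atTop_atTop
  refine (h.comp h2).congr fun n => ?_
  simp only [Function.comp]
  rw [← Real.rpow_mul (by positivity), Real.rpow_def_of_pos (by norm_num : (0 : ℝ) < 1 / 2)]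
  rw [one_div (2 : ℝ), Real.log_inv]
  norm_num

theorem tendsto_probDiamond_of_few_edges (t b : ℕ → ℕ)
    (h : Tendsto (fun n : ℕ => (t n : ℝ) / (n : ℝ) ^ (6 / 5 : ℝ)) atTop (𝓝 0))
    (B : ∀ n, RandomizedStrategy n (t n) (b n)) :
    Tendsto (fun n => (B n).probDiamond) atTop (𝓝 0) := by
  have h2 := (h.pow 5).const_mul (8 ^ 5 : ℝ)
  rw [zero_pow (by norm_num), mul_zero] at h2
  refine squeeze_zero' (Eventually.of_forall fun n => probDiamond_nonneg _) ?_ h2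
  filter_upwards [eventually_ge_atTop 7] with n hn
  exact probDiamond_le _ fun S => S.orderProb_diamond_le_of_time hn

theorem tendsto_probDiamond_of_low_budget (t b : ℕ → ℕ)
    (h : Tendsto (fun n : ℕ => (b n : ℝ) / budgetThreshold n (t n)) atTop (𝓝 0))
    (B : ∀ n, RandomizedStrategy n (t n) (b n)) :
    Tendsto (fun n => (B n).probDiamond) atTop (𝓝 0) := by
  have e1 : Tendsto (fun n : ℕ => (8 : ℝ) ^ 5 * ((n : ℝ) ^ (-(1 / 10) : ℝ)) ^ 5) atTop (𝓝 0) := by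
    have := (((tendsto_rpow_neg_atTop (by norm_num : (0 : ℝ) < 1 / 10)).comp
      tendsto_natCast_atTop_atTop).pow 5).const_mul ((8 : ℝ) ^ 5)
    rw [zero_pow (by norm_num), mul_zero] at this
    exact this
  have e2 := (h.pow 3).const_mul (1280 : ℝ)
  rw [zero_pow (by norm_num), mul_zero] at e2
  have e3 := h.const_mul (3073280 : ℝ)
  rw [mul_zero] at e3
  have hsum := ((e1.add e2).add e3).add tendsto_mul_half_rpow
  simp only [add_zero] at hsum
  refine squeeze_zero' (Eventually.of_forall fun n => probDiamond_nonneg _) ?_ hsum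
  filter_upwards [eventually_ge_atTop 100,
    h.eventually (gt_mem_nhds (by norm_num : (0 : ℝ) < 1 / 4096))] with n hn hx
  refine probDiamond_le _ fun S => ?_
  have hx0 : 0 ≤ (b n : ℝ) / budgetThreshold n (t n) := by
    unfold budgetThreshold; positivity
  have hn' : (100 : ℝ) ≤ n := by exact_mod_cast hn
  have p1 : 0 ≤ (8 : ℝ) ^ 5 * ((n : ℝ) ^ (-(1 / 10) : ℝ)) ^ 5 := by positivity
  have p2 : 0 ≤ 1280 * ((b n : ℝ) / budgetThreshold n (t n)) ^ 3 := by positivity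
  have p3 : 0 ≤ 3073280 * ((b n : ℝ) / budgetThreshold n (t n)) := by positivity
  have p4 : 0 ≤ (n : ℝ) * (1 / 2 : ℝ) ^ ((n : ℝ) ^ (1 / 10 : ℝ)) := by positivity
  -- The first case does not use the budget and contains `t n = 0`, where division by zero makes
  -- `budgetThreshold` equal to 0.
  rcases le_or_gt (t n : ℝ) ((n : ℝ) ^ (11 / 10 : ℝ)) with hsmall | hbig
  · have : (t n : ℝ) / (n : ℝ) ^ (6 / 5 : ℝ) ≤ (n : ℝ) ^ (-(1 / 10) : ℝ) := by
      rw [div_le_iff₀ (by positivity), ← Real.rpow_add (by linarith)]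
      norm_num at hsmall ⊢
      exact hsmall
    have h1 := S.orderProb_diamond_le_of_time (by omega)
    have h2 : 8 ^ 5 * ((t n : ℝ) / (n : ℝ) ^ (6 / 5 : ℝ)) ^ 5 ≤
      (8 : ℝ) ^ 5 * ((n : ℝ) ^ (-(1 / 10) : ℝ)) ^ 5 := by gcongr
    linarith
  rcases Nat.lt_or_ge (n.choose 2) (2 * t n) with hlate | hearly
  · have hT := budgetThreshold_le_of_late (by omega) hlate
    have htpos : (0 : ℝ) < t n := hbig.trans' (by positivity)
    have hTpos : 0 < budgetThreshold n (t n) := lt_max_of_lt_left (by positivity)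
    have hb : b n = 0 := by
      by_contra hb
      have : (1 : ℝ) ≤ b n := by exact_mod_cast Nat.one_le_iff_ne_zero.2 hb
      rw [div_lt_iff₀ hTpos] at hx
      linarith
    have h0 : orderProb (fun σ => diamond.IsContained (S.graphAt σ (t n))) = 0 := by
      -- The budget is a parameter of the type of `S`, so it is generalized before being replaced by
      -- 0.
      have : ∀ (b' : ℕ) (S : Strategy n (t n) b'), b' = 0 →
          orderProb (fun σ => diamond.IsContained (S.graphAt σ (t n))) = 0 := by
        rintro b' S rfl
        exact S.orderProb_diamond_eq_zero
      exact this _ S hb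
    linarith
  · rcases max_choice ((n : ℝ) ^ 6 / (t n : ℝ) ^ 4)
      ((n : ℝ) ^ (4 / 3 : ℝ) / (t n : ℝ) ^ (2 / 3 : ℝ)) with hm | hm
    · have h1 := S.orderProb_diamond_le_sparse hearly hn hbig.le
      rw [← hm] at h1
      change _ ≤ _ + 3073280 * ((b n : ℝ) / budgetThreshold n (t n)) at h1
      linarith
    · have h1 := S.orderProb_diamond_le_star hearly (by omega)
      rw [← hm] at h1
      change _ ≤ 1280 * ((b n : ℝ) / budgetThreshold n (t n)) ^ 3 at h1
      linarith

end upper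

/-! ### The two-phase strategy -/

section firstWanted

open Classical in
/-- Among the first `i` wanted indices, exactly `min` of their number and `b` are among the
first `b` wanted ones. -/
lemma count_first_eq_min (p : ℕ → Prop) (b i : ℕ) :
    Nat.count (fun l => p l ∧ Nat.count p l < b) i = min (Nat.count p i) b := by
  induction i with
  | zero => simp
  | succ i ih =>
    rw [Nat.count_succ, Nat.count_succ, ih]
    by_cases hp : p i
    · by_cases hc : Nat.count p i < b
      · simp only [hp, hc, and_self, if_true]; omega
      · simp only [hp, hc, and_false, if_true, if_false]; omega
    · simp [hp]

open Classical in
lemma count_eq_card_fin {N : ℕ} (p : Fin N → Prop) (i : ℕ) (hi : i ≤ N) :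
    Nat.count (fun l => ∃ h : l < N, p ⟨l, h⟩) i =
      (Finset.univ.filter fun l : Fin N => l.val < i ∧ p l).card := by
  rw [Nat.count_eq_card_filter_range]
  symm
  refine Finset.card_bij' (fun l _ => l.val)
    (fun l hl => ⟨l, (Finset.mem_range.1 (Finset.mem_filter.1 hl).1).trans_le hi⟩) ?_ ?_ ?_ ?_
  · intro l hl
    simp only [Finset.mem_filter, Finset.mem_univ, true_and, Finset.mem_range] at hl ⊢
    exact ⟨hl.1, l.isLt, hl.2⟩
  · intro l hl
    simp only [Finset.mem_filter, Finset.mem_univ, true_and, Finset.mem_range] at hl ⊢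
    exact ⟨hl.1, hl.2.choose_spec⟩
  · intro l _; rfl
  · intro l _; rfl

end firstWanted

/-! ### The rule, its dependence on Builder's graph, and its success criterion -/

section twoPhase

variable {n k m : ℕ}

/-- The edge between a centre and a leaf candidate. -/
def centreEdge (φ : Fin k ⊕ Fin 3 × Fin m ↪ Fin n) (z : Fin k × Fin 3 × Fin m) : KEdge n :=
  ⟨s(φ (Sum.inl z.1), φ (Sum.inr z.2)), by simp⟩

/-- The edge between leaf candidates in consecutive classes. -/
def leafEdge (φ : Fin k ⊕ Fin 3 × Fin m ↪ Fin n) (z : Fin 2 × Fin m × Fin m) : KEdge n :=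
  ⟨s(φ (Sum.inr (z.1.castSucc, z.2.1)), φ (Sum.inr (z.1.succ, z.2.2))), by
    simp [Fin.castSucc_lt_succ.ne]⟩

variable (φ : Fin k ⊕ Fin 3 × Fin m ↪ Fin n)

lemma centreEdge_injective : Function.Injective (centreEdge φ) := by
  rintro ⟨c, z⟩ ⟨c', z'⟩ h
  have := congrArg Subtype.val h
  simpa [centreEdge, Sym2.eq_iff] using this

lemma leafEdge_injective : Function.Injective (leafEdge φ) := by
  rintro ⟨q, u, v⟩ ⟨q', u', v'⟩ h
  have := congrArg Subtype.val h
  simp only [leafEdge, Sym2.eq_iff, φ.injective.eq_iff, Sum.inr.injEq, Prod.mk.injEq] at this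
  rcases this with ⟨⟨h1, h2⟩, h3, h4⟩ | ⟨⟨h1, _⟩, h3, _⟩
  · simp only [Prod.mk.injEq]
    exact ⟨Fin.castSucc_injective _ h1, h2, h4⟩
  · simp only [Fin.ext_iff, Fin.val_castSucc, Fin.val_succ] at h1 h3
    omega

lemma centreEdge_ne_leafEdge (z : Fin k × Fin 3 × Fin m) (z' : Fin 2 × Fin m × Fin m) :
    centreEdge φ z ≠ leafEdge φ z' := by
  intro h
  have := congrArg Subtype.val h
  simp [centreEdge, leafEdge] at this

/-- The edge at time `i` is wanted: it joins a centre to a leaf candidate in the first phase, or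
it joins two leaves of the same centre in the second phase. -/
def IsWanted (a t : ℕ) (σ : EdgeOrder n) (i : Fin (n.choose 2)) : Prop :=
  (i.val < a ∧ ∃ z, σ i = centreEdge φ z) ∨
    ((a ≤ i.val ∧ i.val < t) ∧ ∃ z : Fin 2 × Fin m × Fin m, σ i = leafEdge φ z ∧
      ∃ c, (σ.symm (centreEdge φ (c, z.1.castSucc, z.2.1))).val < a ∧
        (σ.symm (centreEdge φ (c, z.1.succ, z.2.2))).val < a)

/-- In the second phase all positions before `a` lie in the common prefix, so arrival in the first
phase is already decided. -/
lemma IsWanted.congr {a t : ℕ} {σ τ : EdgeOrder n} {i : Fin (n.choose 2)}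
    (h : ∀ j ≤ i, σ j = τ j) (hw : IsWanted φ a t σ i) : IsWanted φ a t τ i := by
  have key : ∀ e, a ≤ i.val → (σ.symm e).val < a → (τ.symm e).val < a := by
    intro e hi he
    have : τ (σ.symm e) = e := by
      rw [← h _ (Fin.le_def.2 (he.trans_le hi).le), Equiv.apply_symm_apply]
    have h2 : τ.symm e = σ.symm e := by rw [Equiv.symm_apply_eq]; exact this.symm
    rwa [h2]
  rcases hw with ⟨h1, z, hz⟩ | ⟨⟨h1, h2⟩, z, hz, c, hc, hc'⟩
  · exact Or.inl ⟨h1, z, by rw [← h i le_rfl, hz]⟩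
  · exact Or.inr ⟨⟨h1, h2⟩, z, by rw [← h i le_rfl, hz], c, key _ h1 hc, key _ h1 hc'⟩

open Classical in
/-- The number of wanted indices smaller than `i`. -/
noncomputable def wantedCount (a t : ℕ) (σ : EdgeOrder n) (i : ℕ) : ℕ :=
  Nat.count (fun l => ∃ h : l < n.choose 2, IsWanted φ a t σ ⟨l, h⟩) i

lemma wantedCount_mono (a t : ℕ) (σ : EdgeOrder n) : Monotone (wantedCount φ a t σ) := by
  classical
  unfold wantedCount
  exact Nat.count_monotone _

lemma wantedCount_congr {a t : ℕ} {σ τ : EdgeOrder n} {i : Fin (n.choose 2)}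
    (h : ∀ j ≤ i, σ j = τ j) : wantedCount φ a t σ i = wantedCount φ a t τ i := by
  classical
  unfold wantedCount
  rw [count_eq_card_fin _ _ i.isLt.le, count_eq_card_fin _ _ i.isLt.le]
  congr 1
  ext l
  simp only [Finset.mem_filter, Finset.mem_univ, true_and, and_congr_right_iff]
  intro hl
  exact ⟨fun hw => hw.congr φ fun j hj => h j (hj.trans (Fin.le_def.2 hl.le)),
    fun hw => hw.congr φ fun j hj => (h j (hj.trans (Fin.le_def.2 hl.le))).symm⟩

open Classical in
lemma card_filter_bought (a t b : ℕ) (σ : EdgeOrder n) {i : ℕ} (hi : i ≤ n.choose 2) :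
    (Finset.univ.filter fun l : Fin (n.choose 2) =>
      l.val < i ∧ IsWanted φ a t σ l ∧ wantedCount φ a t σ l < b).card =
      min (wantedCount φ a t σ i) b := by
  have h := count_eq_card_fin (fun l : Fin (n.choose 2) =>
    IsWanted φ a t σ l ∧ wantedCount φ a t σ l < b) i hi
  refine (Eq.trans (by congr!) h.symm).trans ?_
  have h2 := count_first_eq_min (fun l => ∃ h : l < n.choose 2, IsWanted φ a t σ ⟨l, h⟩) b i
  unfold wantedCount
  convert h2 using 1
  · congr! 3
    simp only [exists_and_right]
    congr!
  · congr!

open Classical in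
/-- The strategy that purchases the first `b` wanted edges. -/
noncomputable def twoPhase {a t : ℕ} (hat : a ≤ t) (b : ℕ) : Strategy n t b where
  buys σ := Finset.univ.filter fun i => IsWanted φ a t σ i ∧ wantedCount φ a t σ i < b
  lt_time σ i hi := by
    rcases (Finset.mem_filter.1 hi).2.1 with ⟨h, _⟩ | ⟨h, _⟩
    · exact h.trans_le hat
    · exact h.2
  card_le σ := by
    refine le_trans (le_of_eq ?_) ((card_filter_bought φ a t b σ le_rfl).le.trans
      (min_le_right _ _))
    congr 1
    ext l
    simp
  online σ τ i h := by
    simp only [Finset.mem_filter, Finset.mem_univ, true_and]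
    rw [wantedCount_congr φ h]
    exact and_congr_left fun _ =>
      ⟨fun hw => hw.congr φ h, fun hw => hw.congr φ fun j hj => (h j hj).symm⟩

variable {a t b : ℕ} (hat : a ≤ t)

lemma mem_twoPhase_buys (σ : EdgeOrder n) (i : Fin (n.choose 2)) :
    i ∈ (twoPhase φ hat b).buys σ ↔ IsWanted φ a t σ i ∧ wantedCount φ a t σ i < b := by
  simp [twoPhase]

-- This makes the remaining budget readable from Builder's graph, although the rule is phrased
-- through edges seen.
open Classical in
lemma twoPhase_card_edges (σ : EdgeOrder n) {i : ℕ} (hi : i ≤ n.choose 2) :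
    (Finset.univ.filter fun e : KEdge n =>
      (e : Sym2 (Fin n)) ∈ ((twoPhase φ hat b).graphAt σ i).edgeSet).card =
      min (wantedCount φ a t σ i) b := by
  rw [← card_filter_bought φ a t b σ hi]
  refine (Finset.card_bij (fun l _ => σ l) ?_ (fun l _ l' _ h => σ.injective h) ?_).symm
  · intro l hl
    simp only [Finset.mem_filter, Finset.mem_univ, true_and] at hl ⊢
    have hb := (mem_twoPhase_buys φ hat σ l).2 hl.2
    generalize he : (σ l : Sym2 (Fin n)) = e
    induction e with
    | _ u v =>
      rw [SimpleGraph.mem_edgeSet, Strategy.graphAt_adj]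
      exact ⟨l, hb, hl.1, he⟩
  · rintro ⟨e, hed⟩ he
    simp only [Finset.mem_filter, Finset.mem_univ, true_and] at he
    induction e with
    | _ u v =>
      rw [SimpleGraph.mem_edgeSet, Strategy.graphAt_adj] at he
      obtain ⟨l, hl, hli, hle⟩ := he
      rw [mem_twoPhase_buys] at hl
      exact ⟨l, by simpa using ⟨hli, hl⟩, Subtype.ext hle⟩

/-- While the budget lasts, no wanted edge has been declined, so after the first phase the graph
records exactly which centre edges arrived in it. -/
lemma twoPhase_adj_centre (σ : EdgeOrder n) {i : Fin (n.choose 2)} (hai : a ≤ i.val)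
    (hc : wantedCount φ a t σ i < b) (z : Fin k × Fin 3 × Fin m) :
    ((twoPhase φ hat b).graphAt σ i).Adj (φ (Sum.inl z.1)) (φ (Sum.inr z.2)) ↔
      (σ.symm (centreEdge φ z)).val < a := by
  rw [Strategy.graphAt_adj]
  constructor
  · rintro ⟨l, hl, hli, he⟩
    have he' : σ l = centreEdge φ z := Subtype.ext he
    rw [mem_twoPhase_buys] at hl
    rcases hl.1 with ⟨h, _⟩ | ⟨_, z', hz', _⟩
    · rwa [← he', Equiv.symm_apply_apply]
    · exact absurd (he'.symm.trans hz') (centreEdge_ne_leafEdge φ z z')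
  · intro h
    refine ⟨σ.symm (centreEdge φ z), ?_, h.trans_le hai, by rw [Equiv.apply_symm_apply]; rfl⟩
    rw [mem_twoPhase_buys]
    exact ⟨Or.inl ⟨h, z, by simp⟩, (wantedCount_mono φ a t σ (h.trans_le hai).le).trans_lt hc⟩

/-- The edge count of the graph tells whether budget is left. If it is, the second-phase test on
arrival times becomes a test of adjacency in the graph. -/
lemma twoPhase_isGraphBased : (twoPhase φ hat b).IsGraphBased := by
  classical
  have key : ∀ (σ τ : EdgeOrder n) (i : Fin (n.choose 2)), σ i = τ i →
      (twoPhase φ hat b).graphAt σ i = (twoPhase φ hat b).graphAt τ i →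
      (i ∈ (twoPhase φ hat b).buys σ → i ∈ (twoPhase φ hat b).buys τ) := by
    intro σ τ i hi hG
    have h1 := twoPhase_card_edges φ (b := b) hat σ i.isLt.le
    have h2 := twoPhase_card_edges φ (b := b) hat τ i.isLt.le
    rw [hG, h2] at h1
    rw [mem_twoPhase_buys, mem_twoPhase_buys]
    rintro ⟨hw, hc⟩
    have hc' : wantedCount φ a t τ i < b := by
      rcases min_lt_iff.1 (h1.trans_lt (min_lt_iff.2 (Or.inl hc))) with h | h
      · exact h
      · exact absurd h (lt_irrefl _)
    refine ⟨?_, hc'⟩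
    rcases hw with ⟨g1, z, hz⟩ | ⟨⟨g1, g2⟩, z, hz, c, g3, g4⟩
    · exact Or.inl ⟨g1, z, by rw [← hi, hz]⟩
    · refine Or.inr ⟨⟨g1, g2⟩, z, by rw [← hi, hz], c, ?_, ?_⟩
      · rw [← twoPhase_adj_centre φ hat τ g1 hc', ← hG, twoPhase_adj_centre φ hat σ g1 hc]
        exact g3
      · rw [← twoPhase_adj_centre φ hat τ g1 hc', ← hG, twoPhase_adj_centre φ hat σ g1 hc]
        exact g4
  exact fun σ τ i hi hG => ⟨key σ τ i hi hG, key τ σ i hi.symm hG.symm⟩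

/-- The centre-to-leaf edges of the diamond with parameters `f`. -/
def starEdges (f : Fin k × Fin m × Fin m × Fin m) : Finset (Fin k × Fin 3 × Fin m) :=
  {(f.1, 0, f.2.1), (f.1, 1, f.2.2.1), (f.1, 2, f.2.2.2)}

/-- The leaf-to-leaf edges of the diamond with parameters `f`. -/
def cherryEdges (f : Fin k × Fin m × Fin m × Fin m) : Finset (Fin 2 × Fin m × Fin m) :=
  {(0, f.2.1, f.2.2.1), (1, f.2.2.1, f.2.2.2)}

/-- Given edges arrive in the first phase, and given ones in the second phase. -/
def ArriveInPhases (a t : ℕ) (S₁ : Finset (Fin k × Fin 3 × Fin m))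
    (S₂ : Finset (Fin 2 × Fin m × Fin m)) (σ : EdgeOrder n) : Prop :=
  (∀ z ∈ S₁, (σ.symm (centreEdge φ z)).val < a) ∧
    ∀ z ∈ S₂, a ≤ (σ.symm (leafEdge φ z)).val ∧ (σ.symm (leafEdge φ z)).val < t

/-- When all wanted edges fit into the budget, each of them is bought, in particular the five edges
of the configuration `f`. -/
lemma twoPhase_diamond {σ : EdgeOrder n} (hb : wantedCount φ a t σ (n.choose 2) ≤ b)
    {f : Fin k × Fin m × Fin m × Fin m}
    (hf : ArriveInPhases φ a t (starEdges f) (cherryEdges f) σ) :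
    diamond.IsContained ((twoPhase φ hat b).graphAt σ t) := by
  classical
  have hbuy : ∀ i, IsWanted φ a t σ i → i ∈ (twoPhase φ hat b).buys σ := by
    intro i hi
    rw [mem_twoPhase_buys]
    refine ⟨hi, lt_of_lt_of_le ?_ hb⟩
    unfold wantedCount
    exact Nat.count_strict_mono ⟨i.isLt, hi⟩ i.isLt
  obtain ⟨c, u, v, w⟩ := f
  obtain ⟨h1, h2⟩ := hf
  simp only [starEdges, cherryEdges, Finset.mem_insert, Finset.mem_singleton, forall_eq_or_imp,
    forall_eq] at h1 h2
  obtain ⟨hu, hv, hw⟩ := h1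
  obtain ⟨huv, hvw⟩ := h2
  have hstar : ∀ z, (σ.symm (centreEdge φ z)).val < a →
      ((twoPhase φ hat b).graphAt σ t).Adj (φ (Sum.inl z.1)) (φ (Sum.inr z.2)) := by
    intro z hz
    rw [Strategy.graphAt_adj]
    exact ⟨_, hbuy _ (Or.inl ⟨hz, z, by simp⟩), hz.trans_le hat, by
      rw [Equiv.apply_symm_apply]; rfl⟩
  have hleaf : ∀ z : Fin 2 × Fin m × Fin m, (σ.symm (centreEdge φ (c, z.1.castSucc, z.2.1))).val < a →
      (σ.symm (centreEdge φ (c, z.1.succ, z.2.2))).val < a →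
      (a ≤ (σ.symm (leafEdge φ z)).val ∧ (σ.symm (leafEdge φ z)).val < t) →
      ((twoPhase φ hat b).graphAt σ t).Adj (φ (Sum.inr (z.1.castSucc, z.2.1)))
        (φ (Sum.inr (z.1.succ, z.2.2))) := by
    intro z h3 h4 h5
    rw [Strategy.graphAt_adj]
    exact ⟨_, hbuy _ (Or.inr ⟨h5, z, by simp, c, h3, h4⟩), h5.2, by
      rw [Equiv.apply_symm_apply]; rfl⟩
  have auv := hleaf (0, u, v) hu hv huv
  have avw := hleaf (1, v, w) hv hw hvw
  have acu := hstar _ hu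
  have acv := hstar _ hv
  have acw := hstar _ hw
  simp only [Fin.castSucc_zero, Fin.succ_zero_eq_one] at auv
  rw [show ((1 : Fin 2).castSucc : Fin 3) = 1 from rfl,
    show ((1 : Fin 2).succ : Fin 3) = 2 from rfl] at avw
  set G := (twoPhase φ hat b).graphAt σ t
  -- The missing edge of the diamond joins the outer leaves `u` and `w`; its spine joins the centre
  -- to the middle leaf `v`.
  have hinj : Function.Injective
      ![φ (Sum.inr (0, u)), φ (Sum.inr (2, w)), φ (Sum.inl c), φ (Sum.inr (1, v))] := by
    intro x y hxy
    fin_cases x <;> fin_cases y <;> first | rfl | simp at hxy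
  refine ⟨⟨⟨_, ?_⟩, hinj⟩⟩
  intro x y hxy
  fin_cases x <;> fin_cases y <;> simp [diamond] at hxy ⊢ <;>
    first | assumption | exact SimpleGraph.Adj.symm ‹_›

end twoPhase

/-! ### Moments for the two-phase strategy -/

section moments

variable {n k m : ℕ} (φ : Fin k ⊕ Fin 3 × Fin m ↪ Fin n)

lemma orderAvg_card_filter {ι : Type*} [Fintype ι] (P : ι → EdgeOrder n → Prop)
    [∀ σ, DecidablePred fun z => P z σ] :
    orderAvg (fun σ => ((Finset.univ.filter fun z => P z σ).card : ℝ)) =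
      ∑ z, orderProb (P z) := by
  classical
  unfold orderProb
  rw [← orderAvg_sum]
  congr 1
  funext σ
  rw [Finset.card_filter, Nat.cast_sum]
  refine Finset.sum_congr rfl fun z _ => ?_
  by_cases h : P z σ <;> simp [h]

/-- Each wanted edge is charged to a centre edge, or to a leaf edge together with two centre edges
at a common centre, all presented by time `t`. There are 3km charges of the first kind and 2km² of
the second. -/
lemma orderAvg_wantedCount_le {a t : ℕ} (hat : a ≤ t) (hN : 6 ≤ n.choose 2) :
    orderAvg (fun σ => (wantedCount φ a t σ (n.choose 2) : ℝ)) ≤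
      3 * k * m * (2 * t / (n.choose 2 : ℝ)) + 2 * k * m ^ 2 * (2 * t / (n.choose 2 : ℝ)) ^ 3 := by
  classical
  set E : (Fin 2 × Fin m × Fin m) × Fin k → Finset (KEdge n) := fun x =>
    {leafEdge φ x.1, centreEdge φ (x.2, x.1.1.castSucc, x.1.2.1),
      centreEdge φ (x.2, x.1.1.succ, x.1.2.2)} with hE
  have hEc : ∀ x, (E x).card = 3 := by
    intro x
    rw [hE, Finset.card_insert_of_notMem, Finset.card_pair]
    · intro h
      have := centreEdge_injective φ h
      simp only [Prod.mk.injEq, true_and] at this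
      exact Fin.castSucc_lt_succ.ne this.1
    · simp only [Finset.mem_insert, Finset.mem_singleton, not_or]
      exact ⟨(centreEdge_ne_leafEdge φ _ _).symm, (centreEdge_ne_leafEdge φ _ _).symm⟩
  have hle : ∀ σ : EdgeOrder n, (wantedCount φ a t σ (n.choose 2) : ℝ) ≤
      ((Finset.univ.filter fun z : Fin k × Fin 3 × Fin m =>
        ∀ e ∈ ({centreEdge φ z} : Finset (KEdge n)), (σ.symm e).val < t).card : ℝ) +
      ((Finset.univ.filter fun x : (Fin 2 × Fin m × Fin m) × Fin k =>
        ∀ e ∈ E x, (σ.symm e).val < t).card : ℝ) := by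
    intro σ
    have h1 : wantedCount φ a t σ (n.choose 2) = (Finset.univ.filter fun l : Fin (n.choose 2) =>
        l.val < n.choose 2 ∧ IsWanted φ a t σ l).card := by
      rw [← count_eq_card_fin _ _ le_rfl]
      unfold wantedCount
      congr!
    rw [h1, ← Nat.cast_add, Nat.cast_le]
    set A := Finset.univ.filter fun z : Fin k × Fin 3 × Fin m =>
        ∀ e ∈ ({centreEdge φ z} : Finset (KEdge n)), (σ.symm e).val < t
    set B := Finset.univ.filter fun x : (Fin 2 × Fin m × Fin m) × Fin k =>
        ∀ e ∈ E x, (σ.symm e).val < t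
    refine (Finset.card_le_card (t := A.image (fun z => σ.symm (centreEdge φ z)) ∪
      B.image (fun x => σ.symm (leafEdge φ x.1))) fun l hl => ?_).trans
      ((Finset.card_union_le _ _).trans (add_le_add Finset.card_image_le Finset.card_image_le))
    rw [Finset.mem_union, Finset.mem_image, Finset.mem_image]
    rcases (Finset.mem_filter.1 hl).2.2 with ⟨g1, z, hz⟩ | ⟨⟨g1, g2⟩, z, hz, c, g3, g4⟩
    · left
      have hz' : σ.symm (centreEdge φ z) = l := by rw [← hz, Equiv.symm_apply_apply]
      refine ⟨z, ?_, hz'⟩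
      simp only [A, Finset.mem_filter, Finset.mem_univ, true_and, Finset.mem_singleton, forall_eq]
      rw [hz']
      exact g1.trans_le hat
    · right
      have hz' : σ.symm (leafEdge φ z) = l := by rw [← hz, Equiv.symm_apply_apply]
      refine ⟨(z, c), ?_, hz'⟩
      simp only [B, hE, Finset.mem_filter, Finset.mem_univ, true_and, Finset.mem_singleton,
        Finset.mem_insert, forall_eq_or_imp, forall_eq]
      rw [hz']
      exact ⟨g2, g3.trans_le hat, g4.trans_le hat⟩
  refine (orderAvg_mono hle).trans ?_
  rw [orderAvg_add, orderAvg_card_filter, orderAvg_card_filter]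
  refine add_le_add ?_ ?_
  · calc _ ≤ ∑ z : Fin k × Fin 3 × Fin m, (2 * t / (n.choose 2 : ℝ)) := by
          refine Finset.sum_le_sum fun z _ => ?_
          have := orderProb_forall_lt_le {centreEdge φ z} t (by simp; omega)
          simpa using this
      _ = _ := by
          simp only [Finset.sum_const, Finset.card_univ, Fintype.card_prod, Fintype.card_fin,
            nsmul_eq_mul]
          push_cast; ring
  · calc _ ≤ ∑ x : (Fin 2 × Fin m × Fin m) × Fin k, (2 * t / (n.choose 2 : ℝ)) ^ 3 := by
          refine Finset.sum_le_sum fun x _ => ?_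
          have := orderProb_forall_lt_le (E x) t (by rw [hEc]; omega)
          rwa [hEc] at this
      _ = _ := by
          simp only [Finset.sum_const, Finset.card_univ, Fintype.card_prod, Fintype.card_fin,
            nsmul_eq_mul]
          push_cast; ring

/-- Times behave like independent uniform ones up to the falling factorial in the denominator. A
pair of diamonds has at most 10 edges, so every factor is at least N - 9. -/
lemma orderProb_arriveInPhases_le {a t : ℕ} (S₁ : Finset (Fin k × Fin 3 × Fin m))
    (S₂ : Finset (Fin 2 × Fin m × Fin m)) (hS : S₁.card + S₂.card ≤ 10) (hN : 10 ≤ n.choose 2) :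
    orderProb (ArriveInPhases φ a t S₁ S₂) ≤ ((a : ℝ) / ((n.choose 2 : ℝ) - 9)) ^ S₁.card *
      (((t - a : ℕ) : ℝ) / ((n.choose 2 : ℝ) - 9)) ^ S₂.card := by
  classical
  set N := n.choose 2 with hNdef
  have hN' : (10 : ℝ) ≤ N := by exact_mod_cast hN
  set E₁ := S₁.image (centreEdge φ) with hE₁
  set E₂ := S₂.image (leafEdge φ) with hE₂
  have hdisj : Disjoint E₁ E₂ := by
    rw [Finset.disjoint_left]
    intro e h1 h2
    obtain ⟨z, _, rfl⟩ := Finset.mem_image.1 h1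
    obtain ⟨z', _, h⟩ := Finset.mem_image.1 h2
    exact centreEdge_ne_leafEdge φ z z' h.symm
  have hc₁ : E₁.card = S₁.card := Finset.card_image_of_injective _ (centreEdge_injective φ)
  have hc₂ : E₂.card = S₂.card := Finset.card_image_of_injective _ (leafEdge_injective φ)
  set I₁ := Finset.univ.filter fun i : Fin N => i.val < a with hI₁
  set I₂ := Finset.univ.filter fun i : Fin N => a ≤ i.val ∧ i.val < t with hI₂
  have hI₁c : (I₁.card : ℝ) ≤ a := by
    have : I₁.card ≤ (Finset.range a).card :=
      Finset.card_le_card_of_injOn (fun i => i.val) (fun i hi => by simpa [hI₁] using hi)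
        (fun i _ j _ h => Fin.ext h)
    rw [Finset.card_range] at this
    exact_mod_cast this
  have hI₂c : (I₂.card : ℝ) ≤ (t - a : ℕ) := by
    have : I₂.card ≤ (Finset.Ico a t).card :=
      Finset.card_le_card_of_injOn (fun i => i.val) (fun i hi => by simpa [hI₂] using hi)
        (fun i _ j _ h => Fin.ext h)
    rw [Nat.card_Ico] at this
    exact_mod_cast this
  have h := orderProb_forall_mem_le (E₁ ∪ E₂) fun e => if e ∈ E₁ then I₁ else I₂
  rw [Finset.prod_union hdisj, Finset.card_union_of_disjoint hdisj, hc₁, hc₂] at h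
  rw [Finset.prod_congr rfl (g := fun _ => (I₁.card : ℝ)) (fun e he => by rw [if_pos he]),
    Finset.prod_congr (s₁ := E₂) rfl (g := fun _ => (I₂.card : ℝ)) (fun e he => by
      rw [if_neg fun h' => Finset.disjoint_left.1 hdisj h' he]),
    Finset.prod_const, Finset.prod_const, hc₁, hc₂] at h
  refine (orderProb_mono fun σ hσ => ?_).trans (h.trans ?_)
  · intro e he
    by_cases he₁ : e ∈ E₁
    · rw [if_pos he₁]
      obtain ⟨z, hz, rfl⟩ := Finset.mem_image.1 he₁
      simpa [hI₁] using hσ.1 z hz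
    · rw [if_neg he₁]
      obtain ⟨z, hz, rfl⟩ := Finset.mem_image.1 ((Finset.mem_union.1 he).resolve_left he₁)
      simpa [hI₂] using hσ.2 z hz
  · rw [div_pow, div_pow, div_mul_div_comm, ← pow_add]
    have hd : ((N : ℝ) - 9) ^ (S₁.card + S₂.card) ≤ (N.descFactorial (S₁.card + S₂.card) : ℝ) := by
      refine le_trans ?_ (pow_le_descFactorial_cast (by omega))
      have : ((S₁.card + S₂.card : ℕ) : ℝ) ≤ 10 := by exact_mod_cast hS
      exact pow_le_pow_left₀ (by linarith) (by linarith) _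
    have h9 : (0 : ℝ) < (N : ℝ) - 9 := by linarith
    gcongr

lemma le_orderProb_arriveInPhases {a t : ℕ} (ha : 2 ≤ a) (hat : a + 1 ≤ t)
    (ht : t ≤ n.choose 2)
    (hN5 : 5 ≤ n.choose 2) (f : Fin k × Fin m × Fin m × Fin m) :
    ((a : ℝ) - 2) ^ 3 * ((t - a : ℕ) - 1 : ℝ) ^ 2 / (n.choose 2 : ℝ) ^ 5 ≤
      orderProb (ArriveInPhases φ a t (starEdges f) (cherryEdges f)) := by
  classical
  obtain ⟨c, u, v, w⟩ := f
  set N := n.choose 2 with hN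
  set e₁ : Fin 3 → KEdge n := fun p => centreEdge φ (c, p, ![u, v, w] p) with he₁
  set e₂ : Fin 2 → KEdge n := fun q => leafEdge φ (q, ![u, v] q, ![v, w] q) with he₂
  have hinj : Function.Injective (Sum.elim e₁ e₂) := by
    refine Function.Injective.sumElim (fun p p' h => ?_) (fun q q' h => ?_) fun p q =>
      centreEdge_ne_leafEdge φ _ _
    · have := centreEdge_injective φ h
      simp only [Prod.mk.injEq] at this
      exact this.2.1
    · have := leafEdge_injective φ h
      simp only [Prod.mk.injEq] at this
      exact this.1
  set Q : (Fin 3 ⊕ Fin 2 ↪ Fin N) → Prop := fun s =>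
    (∀ p, (s (Sum.inl p)).val < a) ∧ ∀ q, a ≤ (s (Sum.inr q)).val ∧ (s (Sum.inr q)).val < t with hQ
  have h := orderProb_times ⟨Sum.elim e₁ e₂, hinj⟩ Q
  have hev : orderProb (ArriveInPhases φ a t (starEdges (c, u, v, w)) (cherryEdges (c, u, v, w))) =
      orderProb fun σ : EdgeOrder n =>
        Q ((⟨Sum.elim e₁ e₂, hinj⟩ : Fin 3 ⊕ Fin 2 ↪ KEdge n).trans σ.symm.toEmbedding) := by
    congr 1
    funext σ
    simp [ArriveInPhases, hQ, starEdges, cherryEdges, he₁, he₂, Fin.forall_fin_succ]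
  rw [hev, h]
  -- Any three distinct times in the first phase and two distinct times in the second combine into
  -- an admissible injection.
  have hcard : a.descFactorial 3 * (t - a).descFactorial 2 ≤ (Finset.univ.filter Q).card := by
    set F : (Fin 3 ↪ Fin a) × (Fin 2 ↪ Fin (t - a)) → (Fin 3 ⊕ Fin 2 ↪ Fin N) := fun g =>
      ⟨Sum.elim (fun p => ⟨(g.1 p).val, by omega⟩) (fun q => ⟨a + (g.2 q).val, by omega⟩), by
        refine Function.Injective.sumElim (fun p p' h => ?_) (fun q q' h => ?_) fun p q h => ?_
        · exact g.1.injective (Fin.ext (by simpa using h))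
        · exact g.2.injective (Fin.ext (by simpa using h))
        · have := congrArg Fin.val h
          simp only at this
          omega⟩ with hF
    have hcF : Fintype.card ((Fin 3 ↪ Fin a) × (Fin 2 ↪ Fin (t - a))) =
        a.descFactorial 3 * (t - a).descFactorial 2 := by
      rw [Fintype.card_prod, Fintype.card_embedding_eq, Fintype.card_embedding_eq]
      simp
    rw [← hcF, ← Finset.card_univ]
    refine Finset.card_le_card_of_injOn F (fun g _ => ?_) fun g _ g' _ hg => ?_
    · simp only [Finset.coe_filter, Finset.mem_univ, true_and, Set.mem_ofPred_eq, hQ, hF]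
      refine ⟨fun p => (g.1 p).isLt, fun q => ⟨Nat.le_add_right _ _, ?_⟩⟩
      have := (g.2 q).isLt
      simp only [Function.Embedding.coeFn_mk, Sum.elim_inr]
      omega
    · refine Prod.ext ?_ ?_
      · ext p
        have := congrArg Fin.val (DFunLike.congr_fun hg (Sum.inl p))
        simpa [hF] using this
      · ext q
        have := congrArg Fin.val (DFunLike.congr_fun hg (Sum.inr q))
        simpa [hF] using this
  have h1 : ((a : ℝ) - 2) ^ 3 ≤ (a.descFactorial 3 : ℝ) := by
    refine le_trans (le_of_eq ?_) (pow_le_descFactorial_cast (by omega))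
    push_cast; ring
  have h2 : ((t - a : ℕ) - 1 : ℝ) ^ 2 ≤ ((t - a).descFactorial 2 : ℝ) := by
    refine le_trans (le_of_eq ?_) (pow_le_descFactorial_cast (by omega))
    push_cast; ring
  have h3 : ((n.choose 2).descFactorial (Fintype.card (Fin 3 ⊕ Fin 2)) : ℝ) ≤
      (n.choose 2 : ℝ) ^ 5 := by
    have := Nat.descFactorial_le_pow (n.choose 2) 5
    simp only [Fintype.card_sum, Fintype.card_fin]
    exact_mod_cast this
  have h4 : (0 : ℝ) < ((n.choose 2).descFactorial (Fintype.card (Fin 3 ⊕ Fin 2)) : ℝ) := by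
    have : 0 < N.descFactorial 5 := Nat.descFactorial_pos.2 (by omega)
    simp only [Fintype.card_sum, Fintype.card_fin]
    exact_mod_cast this
  have ha' : (2 : ℝ) ≤ a := by exact_mod_cast ha
  refine div_le_div₀ (by positivity) ?_ h4 h3
  calc _ ≤ (a.descFactorial 3 : ℝ) * ((t - a).descFactorial 2 : ℝ) := by gcongr
    _ ≤ _ := by
      rw [← Nat.cast_mul, Nat.cast_le]
      convert hcard

end moments

/-! ### Overlaps of two diamonds and the second moment -/

section secondMoment

variable {n k m : ℕ} (φ : Fin k ⊕ Fin 3 × Fin m ↪ Fin n)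

/-- Star edges of two diamonds coincide only at a common centre and, the classes being disjoint,
only in the same role. -/
lemma card_starEdges_union (c c' : Fin k) (u v w u' v' w' : Fin m) :
    (starEdges (c, u, v, w) ∪ starEdges (c', u', v', w')).card +
      (if c = c' then (if u = u' then 1 else 0) + (if v = v' then 1 else 0) +
        (if w = w' then 1 else 0) else 0) = 6 := by
  by_cases hc : c = c' <;> by_cases hu : u = u' <;> by_cases hv : v = v' <;>
    by_cases hw : w = w' <;>
    simp [starEdges, Finset.insert_union, hc, hu, hv, hw,
      eq_comm (a := c') (b := c), eq_comm (a := u') (b := u), eq_comm (a := v') (b := v)]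

/-- Both cherry edges contain the middle leaf, so a coincidence requires equal middle leaves. -/
lemma card_cherryEdges_union (c c' : Fin k) (u v w u' v' w' : Fin m) :
    (cherryEdges (c, u, v, w) ∪ cherryEdges (c', u', v', w')).card +
      (if v = v' then (if u = u' then 1 else 0) + (if w = w' then 1 else 0) else 0) = 4 := by
  by_cases hu : u = u' <;> by_cases hv : v = v' <;> by_cases hw : w = w' <;>
    simp [cherryEdges, Finset.insert_union, hu, hv, hw,
      eq_comm (a := u') (b := u), eq_comm (a := v') (b := v)]

/-- The indicator of equality. -/
def eqInd {A : Type*} [DecidableEq A] (x y : A) : ℝ := if x = y then 1 else 0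

lemma sum_sum_eqInd {A : Type*} [Fintype A] [DecidableEq A] :
    ∑ x : A, ∑ y : A, eqInd x y = Fintype.card A := by
  simp [eqInd]

lemma sum_sum_mul_prod {A B : Type*} [Fintype A] [Fintype B] (g : A → A → ℝ) (h : B → B → ℝ) :
    ∑ x : A × B, ∑ y : A × B, g x.1 y.1 * h x.2 y.2 =
      (∑ x, ∑ y, g x y) * ∑ x, ∑ y, h x y := by
  simp only [Fintype.sum_prod_type, ← Finset.mul_sum, ← Finset.sum_mul]

/-- Each shared edge removes a factor α or γ, both at least 1/r, and so costs at most a factor r. -/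
lemma pow_mul_pow_le_of_add_eq {α γ r : ℝ} (hα : 0 < α) (hγ : 0 < γ) (hαr : 1 ≤ α * r)
    (hγr : 1 ≤ γ * r) {x y i j : ℕ} (hx : x + i = 6) (hy : y + j = 4) :
    α ^ x * γ ^ y ≤ α ^ 6 * γ ^ 4 * r ^ (i + j) := by
  rw [← hx, ← hy]
  have h1 : 1 ≤ (α * r) ^ i := one_le_pow₀ hαr
  have h2 : 1 ≤ (γ * r) ^ j := one_le_pow₀ hγr
  calc α ^ x * γ ^ y = α ^ x * γ ^ y * (1 * 1) := by ring
    _ ≤ α ^ x * γ ^ y * ((α * r) ^ i * (γ * r) ^ j) := by gcongr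
    _ = _ := by rw [mul_pow, mul_pow]; ring

/-- The weight bounding the effect of coinciding edges in a pair of diamonds. -/
noncomputable def overlapWeight (r : ℝ) (f f' : Fin k × Fin m × Fin m × Fin m) : ℝ :=
  let c := eqInd f.1 f'.1
  let u := eqInd f.2.1 f'.2.1
  let v := eqInd f.2.2.1 f'.2.2.1
  let w := eqInd f.2.2.2 f'.2.2.2
  1 * (1 * (1 * 1)) + r * (c * (u * (1 * 1))) + r * (c * (1 * (v * 1))) + r * (c * (1 * (1 * w))) +
    r * (1 * (u * (v * 1))) + r * (1 * (1 * (v * w))) + r ^ 2 * (c * (u * (1 * w))) +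
    r ^ 3 * (c * (u * (v * 1))) + r ^ 3 * (c * (1 * (v * w))) + r ^ 2 * (1 * (u * (v * w))) +
    r ^ 5 * (c * (u * (v * w)))

/-- The weight has one term for each pattern of equal coordinates that forces shared edges, with
exponent the number of these edges, plus 1 for no shared edge. The exact pattern of the pair
supplies the required term and the others are nonnegative. -/
lemma pow_card_union_le {α γ r : ℝ} (hα : 0 < α) (hγ : 0 < γ) (hr : 0 ≤ r) (hαr : 1 ≤ α * r)
    (hγr : 1 ≤ γ * r) (f f' : Fin k × Fin m × Fin m × Fin m) :
    α ^ (starEdges f ∪ starEdges f').card * γ ^ (cherryEdges f ∪ cherryEdges f').card ≤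
      α ^ 6 * γ ^ 4 * overlapWeight r f f' := by
  obtain ⟨c, u, v, w⟩ := f
  obtain ⟨c', u', v', w'⟩ := f'
  refine (pow_mul_pow_le_of_add_eq hα hγ hαr hγr (card_starEdges_union c c' u v w u' v' w')
    (card_cherryEdges_union c c' u v w u' v' w')).trans ?_
  gcongr
  simp only [overlapWeight, eqInd]
  by_cases hc : c = c' <;> by_cases hu : u = u' <;> by_cases hv : v = v' <;>
    by_cases hw : w = w' <;> simp only [hc, hu, hv, hw, if_true, if_false] <;> ring_nf <;>
    linarith [pow_nonneg hr 2, pow_nonneg hr 3, pow_nonneg hr 5]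

/-- Every term is a product over coordinates, so its sum factors: an equality indicator contributes
k or m, a free coordinate k² or m². -/
lemma sum_overlapWeight (r : ℝ) :
    ∑ f : Fin k × Fin m × Fin m × Fin m, ∑ f' : Fin k × Fin m × Fin m × Fin m,
      overlapWeight r f f' =
    k ^ 2 * m ^ 6 + 3 * r * k * m ^ 5 + 2 * r * k ^ 2 * m ^ 4 + r ^ 2 * k * m ^ 4 +
      2 * r ^ 3 * k * m ^ 4 + r ^ 2 * k ^ 2 * m ^ 3 + r ^ 5 * k * m ^ 3 := by
  have key : ∀ (x : ℝ) (g₁ : Fin k → Fin k → ℝ) (g₂ g₃ g₄ : Fin m → Fin m → ℝ),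
      ∑ f : Fin k × Fin m × Fin m × Fin m, ∑ f' : Fin k × Fin m × Fin m × Fin m,
        x * (g₁ f.1 f'.1 * (g₂ f.2.1 f'.2.1 * (g₃ f.2.2.1 f'.2.2.1 * g₄ f.2.2.2 f'.2.2.2))) =
      x * ((∑ a, ∑ b, g₁ a b) * ((∑ a, ∑ b, g₂ a b) * ((∑ a, ∑ b, g₃ a b) *
        ∑ a, ∑ b, g₄ a b))) := by
    intro x g₁ g₂ g₃ g₄
    rw [← sum_sum_mul_prod g₃ g₄, ← sum_sum_mul_prod g₂, ← sum_sum_mul_prod g₁]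
    simp only [Finset.mul_sum]
  have one : ∀ N : ℕ, ∑ _x : Fin N, ∑ _y : Fin N, (1 : ℝ) = N ^ 2 := by
    intro N; simp; ring
  have k2 := key r eqInd eqInd (fun _ _ => 1) (fun _ _ => 1)
  have k3 := key r eqInd (fun _ _ => 1) eqInd (fun _ _ => 1)
  have k4 := key r eqInd (fun _ _ => 1) (fun _ _ => 1) eqInd
  have k5 := key r (fun _ _ => 1) eqInd eqInd (fun _ _ => 1)
  have k6 := key r (fun _ _ => 1) (fun _ _ => 1) eqInd eqInd
  have k7 := key (r ^ 2) eqInd eqInd (fun _ _ => 1) eqInd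
  have k8 := key (r ^ 3) eqInd eqInd eqInd (fun _ _ => 1)
  have k9 := key (r ^ 3) eqInd (fun _ _ => 1) eqInd eqInd
  have k10 := key (r ^ 2) (fun _ _ => 1) eqInd eqInd eqInd
  have k11 := key (r ^ 5) eqInd eqInd eqInd eqInd
  simp only [overlapWeight, Finset.sum_add_distrib]
  have k1' : ∑ f : Fin k × Fin m × Fin m × Fin m, ∑ f' : Fin k × Fin m × Fin m × Fin m,
      ((1 : ℝ) * (1 * (1 * 1))) = (k : ℝ) ^ 2 * ((m : ℝ) ^ 2 * ((m : ℝ) ^ 2 * (m : ℝ) ^ 2)) := by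
    simp; ring
  rw [k1', k2, k3, k4, k5, k6, k7, k8, k9, k10, k11, one, one, sum_sum_eqInd, sum_sum_eqInd,
    Fintype.card_fin, Fintype.card_fin]
  ring

/-- The second moment bound for the number of diamonds arriving in two phases. -/
lemma orderProb_no_diamond_le {a t : ℕ} (ha : 3 ≤ a) (hat : a + 2 ≤ t) (ht : t ≤ n.choose 2)
    (hN : 10 ≤ n.choose 2) (hk : 0 < k) (hm : 0 < m) {r : ℝ}
    (hr₁ : 1 ≤ (a : ℝ) / ((n.choose 2 : ℝ) - 9) * r)
    (hr₂ : 1 ≤ ((t - a : ℕ) : ℝ) / ((n.choose 2 : ℝ) - 9) * r) :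
    orderProb (fun σ => ¬ ∃ f : Fin k × Fin m × Fin m × Fin m,
      ArriveInPhases φ a t (starEdges f) (cherryEdges f) σ) ≤
      ((n.choose 2 : ℝ) / ((n.choose 2 : ℝ) - 9)) ^ 10 * ((a : ℝ) / (a - 2)) ^ 6 *
        (((t - a : ℕ) : ℝ) / ((t - a : ℕ) - 1)) ^ 4 *
        (1 + 3 * (r / (k * m)) + 2 * (r / m ^ 2) + r ^ 2 / (k * m ^ 2) +
          2 * (r ^ 3 / (k * m ^ 2)) + r ^ 2 / m ^ 3 + r ^ 5 / (k * m ^ 3)) - 1 := by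
  classical
  have hN' : (10 : ℝ) ≤ n.choose 2 := by exact_mod_cast hN
  have ha' : (3 : ℝ) ≤ a := by exact_mod_cast ha
  have hta : (2 : ℝ) ≤ (t - a : ℕ) := by
    have : 2 ≤ t - a := by omega
    exact_mod_cast this
  have hk' : (0 : ℝ) < k := by exact_mod_cast hk
  have hm' : (0 : ℝ) < m := by exact_mod_cast hm
  set N : ℝ := ((n.choose 2 : ℕ) : ℝ) with hNdef
  set d : ℝ := ((t - a : ℕ) : ℝ) with hd
  set α : ℝ := a / (N - 9) with hα
  set γ : ℝ := d / (N - 9) with hγ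
  have h9 : 0 < N - 9 := by linarith
  have hα0 : 0 < α := div_pos (by linarith) h9
  have hγ0 : 0 < γ := div_pos (by linarith) h9
  have hr : 0 ≤ r := by
    by_contra h
    push Not at h
    nlinarith
  set L : ℝ := ((a : ℝ) - 2) ^ 3 * (d - 1) ^ 2 / N ^ 5 with hL
  have ha2 : 0 < (a : ℝ) - 2 := by linarith
  have hd1 : 0 < d - 1 := by linarith
  have hN0 : 0 < N := by linarith
  have hL0 : 0 < L := by positivity
  set P : Fin k × Fin m × Fin m × Fin m → EdgeOrder n → Prop := fun f =>
    ArriveInPhases φ a t (starEdges f) (cherryEdges f) with hP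
  set X : EdgeOrder n → ℝ := fun σ => ((Finset.univ.filter fun f => P f σ).card : ℝ) with hX
  have hmean : k * m ^ 3 * L ≤ orderAvg X := by
    rw [hX, orderAvg_card_filter]
    calc (k : ℝ) * m ^ 3 * L = ∑ _f : Fin k × Fin m × Fin m × Fin m, L := by
          simp only [Finset.sum_const, Finset.card_univ, Fintype.card_prod, Fintype.card_fin,
            nsmul_eq_mul]
          push_cast; ring
      _ ≤ _ := Finset.sum_le_sum fun f _ =>
          le_orderProb_arriveInPhases φ (by omega) (by omega) ht (by omega) f
  have hsq : orderAvg (fun σ => X σ ^ 2) ≤ α ^ 6 * γ ^ 4 * (k ^ 2 * m ^ 6 + 3 * r * k * m ^ 5 +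
      2 * r * k ^ 2 * m ^ 4 + r ^ 2 * k * m ^ 4 + 2 * r ^ 3 * k * m ^ 4 + r ^ 2 * k ^ 2 * m ^ 3 +
      r ^ 5 * k * m ^ 3) := by
    have h1 : ∀ σ, X σ ^ 2 = ((Finset.univ.filter fun x : (Fin k × Fin m × Fin m × Fin m) ×
        (Fin k × Fin m × Fin m × Fin m) => P x.1 σ ∧ P x.2 σ).card : ℝ) := by
      intro σ
      rw [hX, sq, ← Nat.cast_mul, ← Finset.card_product, ← Finset.filter_product,
        Finset.univ_product_univ]
    simp only [h1]
    rw [orderAvg_card_filter (fun (x : (Fin k × Fin m × Fin m × Fin m) ×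
      (Fin k × Fin m × Fin m × Fin m)) σ => P x.1 σ ∧ P x.2 σ), Fintype.sum_prod_type,
      ← sum_overlapWeight, Finset.mul_sum]
    refine Finset.sum_le_sum fun f _ => ?_
    rw [Finset.mul_sum]
    refine Finset.sum_le_sum fun f' _ => ?_
    refine (orderProb_mono (Q := ArriveInPhases φ a t (starEdges f ∪ starEdges f')
      (cherryEdges f ∪ cherryEdges f')) fun σ hσ => ⟨fun z hz => ?_, fun z hz => ?_⟩).trans
      ((orderProb_arriveInPhases_le φ _ _ ?_ hN).trans
        (pow_card_union_le hα0 hγ0 hr hr₁ hr₂ f f'))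
    · rcases Finset.mem_union.1 hz with h | h
      exacts [hσ.1.1 z h, hσ.2.1 z h]
    · rcases Finset.mem_union.1 hz with h | h
      exacts [hσ.1.2 z h, hσ.2.2 z h]
    · obtain ⟨c, u, v, w⟩ := f
      obtain ⟨c', u', v', w'⟩ := f'
      have e1 := card_starEdges_union c c' u v w u' v' w'
      have e2 := card_cherryEdges_union c c' u v w u' v' w'
      omega
  have hev : orderProb (fun σ => ¬ ∃ f, P f σ) ≤ orderProb fun σ => X σ = 0 := by
    refine orderProb_mono fun σ hσ => ?_
    simp only [hX, Nat.cast_eq_zero, Finset.card_eq_zero]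
    exact Finset.filter_eq_empty_iff.2 fun f _ hf => hσ ⟨f, hf⟩
  -- The second moment is divided by (km³L)², with L the lower bound for a single diamond; the three
  -- leading ratios measure the discrepancy between the upper and lower estimates.
  refine hev.trans ((orderProb_eq_zero_le (by positivity) hmean).trans ?_)
  gcongr
  rw [div_le_iff₀ (by positivity)]
  refine hsq.trans (le_of_eq ?_)
  rw [hL, hα, hγ]
  field_simp

end secondMoment

/-! ### Choice of parameters and the lower bound -/

section lower

variable {n t b k m : ℕ}

lemma div_sub_le_div_sub {x y c e : ℝ} (he : e < y) (h : c * y ≤ e * x) (hx : c < x) :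
    x / (x - c) ≤ y / (y - e) := by
  rw [div_le_div_iff₀ (by linarith) (by linarith)]
  nlinarith

/-- With `q = t / n²`, the two-phase strategy with `k` centres and three classes of `m` leaf
candidates fails with small probability. -/
lemma exists_strategy (ht : 10 ≤ t) (htN : t ≤ n.choose 2) (hk : 0 < k) (hm : 0 < m) (hb : 0 < b)
    (hkm : k + 3 * m ≤ n) {q : ℝ} (hq : q = t / (n : ℝ) ^ 2) :
    ∃ B : Strategy n t b, B.IsGraphBased ∧
      1 - RandomizedStrategy.probDiamond (PMF.pure B) ≤
        (((t : ℝ) / (t - 9)) ^ 20 * (1 + 64 * (1 / (k * m * q) + 1 / (m ^ 2 * q) +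
          1 / (k * m ^ 2 * q ^ 3) + 1 / (m ^ 3 * q ^ 2) + 1 / (k * m ^ 3 * q ^ 5))) - 1) +
        (24 * (k * m * q) + 1024 * (k * m ^ 2 * q ^ 3)) / b := by
  classical
  obtain ⟨φ⟩ : Nonempty (Fin k ⊕ Fin 3 × Fin m ↪ Fin n) :=
    Function.Embedding.nonempty_of_card_le (by simpa using hkm)
  set a := t / 2 with ha
  have hat : a ≤ t := Nat.div_le_self _ _
  have hn : 2 ≤ n := by omega
  have hN1 := sq_div_four_le_choose_two hn
  have hN2 := choose_two_le_sq_div_two (n := n)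
  have htN' : (t : ℝ) ≤ n.choose 2 := by exact_mod_cast htN
  have ht' : (10 : ℝ) ≤ t := by exact_mod_cast ht
  have hn0 : (0 : ℝ) < n := by exact_mod_cast (by omega : 0 < n)
  have hk' : (0 : ℝ) < k := by exact_mod_cast hk
  have hm' : (0 : ℝ) < m := by exact_mod_cast hm
  have hb' : (0 : ℝ) < b := by exact_mod_cast hb
  have ha3 : (t : ℝ) ≤ 3 * a := by exact_mod_cast (by omega : t ≤ 3 * a)
  have hd3 : (t : ℝ) ≤ 3 * (t - a : ℕ) := by exact_mod_cast (by omega : t ≤ 3 * (t - a))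
  have hq0 : 0 < q := by rw [hq]; positivity
  have hq1 : q ≤ 1 := by
    rw [hq, div_le_one (by positivity)]
    nlinarith
  refine ⟨twoPhase φ hat b, twoPhase_isGraphBased φ hat, ?_⟩
  rw [probDiamond_pure, ← orderProb_compl]
  refine (orderProb_mono (Q := fun σ => (¬ ∃ f : Fin k × Fin m × Fin m × Fin m,
    ArriveInPhases φ a t (starEdges f) (cherryEdges f) σ) ∨
    (b : ℝ) < wantedCount φ a t σ (n.choose 2)) fun σ hσ => ?_).trans
    ((orderProb_or_le _ _).trans (add_le_add ?_ ?_))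
  · by_contra h
    push Not at h
    obtain ⟨⟨f, hf⟩, hw⟩ := h
    exact hσ (twoPhase_diamond φ hat (by exact_mod_cast hw) hf)
  -- Each phase has at least t/3 edges and N ≤ n²/2, so r = 2/q satisfies both hypotheses on `r`.
  · set r : ℝ := 2 / q with hr
    have hr0 : 0 < r := by positivity
    have hscale : ∀ x : ℝ, (t : ℝ) ≤ 3 * x → 1 ≤ x / ((n.choose 2 : ℝ) - 9) * r := by
      intro x hx
      have h9 : (0 : ℝ) < (n.choose 2 : ℝ) - 9 := by linarith
      rw [hr, hq, div_div_eq_mul_div, div_mul_div_comm, one_le_div (by positivity)]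
      nlinarith
    refine (orderProb_no_diamond_le φ (a := a) (t := t) (by omega) (by omega) htN (by omega) hk hm
      (hscale _ ha3) (hscale _ hd3)).trans ?_
    have e1 : (n.choose 2 : ℝ) / ((n.choose 2 : ℝ) - 9) ≤ t / (t - 9) :=
      div_sub_le_div_sub (by linarith) (by linarith) (by linarith)
    have e2 : (a : ℝ) / (a - 2) ≤ t / (t - 9) :=
      div_sub_le_div_sub (by linarith) (by linarith) (by linarith)
    have e3 : ((t - a : ℕ) : ℝ) / ((t - a : ℕ) - 1) ≤ t / (t - 9) :=
      div_sub_le_div_sub (by linarith) (by linarith) (by linarith)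
    have p1 : (0 : ℝ) ≤ (n.choose 2 : ℝ) / ((n.choose 2 : ℝ) - 9) :=
      div_nonneg (by linarith) (by linarith)
    have p2 : (0 : ℝ) ≤ (a : ℝ) / (a - 2) := div_nonneg (by linarith) (by linarith)
    have p3 : (0 : ℝ) ≤ ((t - a : ℕ) : ℝ) / ((t - a : ℕ) - 1) :=
      div_nonneg (by linarith) (by linarith)
    have p4 : (0 : ℝ) ≤ (t : ℝ) / (t - 9) := div_nonneg (by linarith) (by linarith)
    refine sub_le_sub_right (mul_le_mul ?_ ?_ (by positivity) (by positivity)) 1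
    · calc _ ≤ ((t : ℝ) / (t - 9)) ^ 10 * (t / (t - 9)) ^ 6 * (t / (t - 9)) ^ 4 := by gcongr
        _ = _ := by ring
    · have f1 : r / (k * m) = 2 * (1 / (k * m * q)) := by rw [hr]; field_simp
      have f2 : r / (m : ℝ) ^ 2 = 2 * (1 / (m ^ 2 * q)) := by rw [hr]; field_simp
      have f3 : r ^ 2 / (k * (m : ℝ) ^ 2) ≤ 4 * (1 / (k * m ^ 2 * q ^ 3)) := by
        have : r ^ 2 / (k * (m : ℝ) ^ 2) = 4 * (1 / (k * m ^ 2 * q ^ 2)) := by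
          rw [hr]; field_simp; norm_num
        rw [this]
        have : q ^ 3 ≤ q ^ 2 := pow_le_pow_of_le_one hq0.le hq1 (by norm_num)
        gcongr
      have f4 : r ^ 3 / (k * (m : ℝ) ^ 2) = 8 * (1 / (k * m ^ 2 * q ^ 3)) := by
        rw [hr]; field_simp; norm_num
      have f5 : r ^ 2 / (m : ℝ) ^ 3 = 4 * (1 / (m ^ 3 * q ^ 2)) := by
        rw [hr]; field_simp; norm_num
      have f6 : r ^ 5 / (k * (m : ℝ) ^ 3) = 32 * (1 / (k * m ^ 3 * q ^ 5)) := by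
        rw [hr]; field_simp; norm_num
      rw [f1, f2, f4, f5, f6]
      have g1 : 0 ≤ 1 / (k * m * q) := by positivity
      have g2 : 0 ≤ 1 / ((m : ℝ) ^ 2 * q) := by positivity
      have g3 : 0 ≤ 1 / (k * (m : ℝ) ^ 2 * q ^ 3) := by positivity
      have g4 : 0 ≤ 1 / ((m : ℝ) ^ 3 * q ^ 2) := by positivity
      have g5 : 0 ≤ 1 / (k * (m : ℝ) ^ 3 * q ^ 5) := by positivity
      linarith
  · refine (orderProb_lt_le (fun σ => by positivity) hb').trans ?_
    gcongr
    refine (orderAvg_wantedCount_le φ hat (by omega)).trans ?_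
    have h8 : 2 * t / (n.choose 2 : ℝ) ≤ 8 * q := by
      rw [hq]
      calc _ ≤ 2 * t / ((n : ℝ) ^ 2 / 4) := by gcongr
        _ = _ := by field_simp; ring
    calc _ ≤ 3 * k * m * (8 * q) + 2 * k * (m : ℝ) ^ 2 * (8 * q) ^ 3 := by gcongr
      _ = _ := by ring

/-- The choice of the numbers of centres and of leaf candidates; here `s ^ 3 = t / n²`. -/
lemma exists_parameters {s g : ℝ} (hs : 0 < s) (hs1 : s ≤ 1) (hg : 17 ≤ g)
    (h : g ^ 5 ≤ (n : ℝ) ^ 4 * s ^ 15) :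
    ∃ k m : ℕ, 0 < k ∧ 0 < m ∧ k + 3 * m ≤ n ∧
      g / 512 ≤ k * m * s ^ 3 ∧ g / 512 ≤ m ^ 2 * s ^ 3 ∧ g / 512 ≤ k * m ^ 2 * (s ^ 3) ^ 3 ∧
      g / 512 ≤ m ^ 3 * (s ^ 3) ^ 2 ∧ g / 512 ≤ k * m ^ 3 * (s ^ 3) ^ 5 ∧
      24 * (k * m * s ^ 3) + 1024 * (k * m ^ 2 * (s ^ 3) ^ 3) ≤
        20000 * g ^ 4 * max (1 / ((n : ℝ) ^ 2 * s ^ 12)) (1 / s ^ 2) := by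
  have hg0 : 0 < g := by linarith
  have hg1 : 1 ≤ g := by linarith
  have hg2 : g ≤ g ^ 2 := by nlinarith
  have hg3 : g ≤ g ^ 3 := le_self_pow₀ hg1 (by norm_num)
  have hspow : ∀ i j : ℕ, i ≤ j → s ^ j ≤ s ^ i := fun i j hij =>
    pow_le_pow_of_le_one hs.le hs1 hij
  have hn4 : g ^ 4 ≤ (n : ℝ) ^ 4 * s ^ 12 := by
    calc g ^ 4 ≤ g ^ 5 := pow_le_pow_right₀ hg1 (by norm_num)
      _ ≤ (n : ℝ) ^ 4 * s ^ 15 := h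
      _ ≤ _ := by gcongr ?_ * ?_; exact hspow 12 15 (by norm_num)
  have hns3 : g ≤ n * s ^ 3 := by
    refine le_of_pow_le_pow_left₀ (n := 4) (by norm_num) (by positivity) ?_
    rw [mul_pow, ← pow_mul]; exact hn4
  have hgn : g ≤ n := hns3.trans (mul_le_of_le_one_right (by positivity) (pow_le_one₀ hs.le hs1))
  have hn0 : (0 : ℝ) < n := by linarith
  -- The critical requirement is km³q⁵ ≫ 1, with q = s³. For k = 1 it asks for m near g/s⁵, which
  -- fits exactly when this is at most n/4. Otherwise m is of order n and several centres are used.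
  rcases le_or_gt (4 * g) (n * s ^ 5) with hdense | hsparse
  · have hmceil : g / s ^ 5 ≤ (⌈g / s ^ 5⌉₊ : ℝ) := Nat.le_ceil _
    have hmlt : (⌈g / s ^ 5⌉₊ : ℝ) < g / s ^ 5 + 1 := Nat.ceil_lt_add_one (by positivity)
    have hmpos : 0 < ⌈g / s ^ 5⌉₊ := Nat.ceil_pos.2 (by positivity)
    generalize ⌈g / s ^ 5⌉₊ = m at *
    have hgs : g / s ^ 5 ≤ n / 4 := by
      rw [div_le_iff₀ (by positivity)]; linarith
    have hone : 1 ≤ g / s ^ 5 := by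
      rw [one_le_div (by positivity)]
      exact (pow_le_one₀ hs.le hs1).trans hg1
    have hm2 : (m : ℝ) ≤ 2 * (g / s ^ 5) := by linarith
    have hm0 : (0 : ℝ) < m := by exact_mod_cast hmpos
    have inv_ge : ∀ i : ℕ, 1 ≤ 1 / s ^ i := fun i => by
      rw [one_le_div (by positivity)]; exact pow_le_one₀ hs.le hs1
    have hm_ge : ∀ (x c : ℝ) (i : ℕ), g ≤ c → c * (1 / s ^ i) ≤ x → g / 512 ≤ x := by
      intro x c i hc hx
      have : c ≤ c * (1 / s ^ i) := le_mul_of_one_le_right (by linarith) (inv_ge i)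
      linarith
    refine ⟨1, m, one_pos, hmpos, ?_, ?_, ?_, ?_, ?_, ?_, ?_⟩
    · have : (1 : ℝ) + 3 * m ≤ n := by linarith
      exact_mod_cast this
    · refine hm_ge _ g 2 le_rfl ?_
      calc g * (1 / s ^ 2) = (1 : ℕ) * (g / s ^ 5) * s ^ 3 := by field_simp; norm_num
        _ ≤ _ := by gcongr
    · refine hm_ge _ (g ^ 2) 7 hg2 ?_
      calc g ^ 2 * (1 / s ^ 7) = (g / s ^ 5) ^ 2 * s ^ 3 := by field_simp
        _ ≤ _ := by gcongr
    · refine hm_ge _ (g ^ 2) 1 hg2 ?_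
      calc g ^ 2 * (1 / s ^ 1) = (1 : ℕ) * (g / s ^ 5) ^ 2 * (s ^ 3) ^ 3 := by field_simp; norm_num
        _ ≤ _ := by gcongr
    · refine hm_ge _ (g ^ 3) 9 hg3 ?_
      calc g ^ 3 * (1 / s ^ 9) = (g / s ^ 5) ^ 3 * (s ^ 3) ^ 2 := by field_simp
        _ ≤ _ := by gcongr
    · refine hm_ge _ (g ^ 3) 0 hg3 ?_
      calc g ^ 3 * (1 / s ^ 0) = (1 : ℕ) * (g / s ^ 5) ^ 3 * (s ^ 3) ^ 5 := by field_simp; norm_num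
        _ ≤ _ := by gcongr
    · have e1 : ((1 : ℕ) : ℝ) * m * s ^ 3 ≤ 2 * g * (1 / s ^ 2) := by
        calc _ ≤ ((1 : ℕ) : ℝ) * (2 * (g / s ^ 5)) * s ^ 3 := by gcongr
          _ = _ := by field_simp; norm_num
      have e2 : ((1 : ℕ) : ℝ) * m ^ 2 * (s ^ 3) ^ 3 ≤ 4 * g ^ 2 * (1 / s ^ 2) := by
        calc _ ≤ ((1 : ℕ) : ℝ) * (2 * (g / s ^ 5)) ^ 2 * (s ^ 3) ^ 3 := by gcongr
          _ = 4 * g ^ 2 * (1 / s ^ 1) := by field_simp; norm_num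
          _ ≤ _ := by gcongr 4 * g ^ 2 * (1 / ?_); exact hspow 1 2 (by norm_num)
      have hg4 : 24 * (2 * g) + 1024 * (4 * g ^ 2) ≤ 20000 * g ^ 4 := by
        have : g ^ 2 ≤ g ^ 4 := pow_le_pow_right₀ hg1 (by norm_num)
        nlinarith
      calc _ ≤ 24 * (2 * g * (1 / s ^ 2)) + 1024 * (4 * g ^ 2 * (1 / s ^ 2)) := by linarith
        _ = (24 * (2 * g) + 1024 * (4 * g ^ 2)) * (1 / s ^ 2) := by ring
        _ ≤ 20000 * g ^ 4 * (1 / s ^ 2) := by gcongr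
        _ ≤ _ := by gcongr; exact le_max_right _ _
  · have hn16 : 16 ≤ n := by
      have : (16 : ℝ) ≤ n := by linarith
      exact_mod_cast this
    obtain ⟨m, hmdef⟩ : ∃ m, m = n / 4 := ⟨_, rfl⟩
    have hm1 : (n : ℝ) / 8 ≤ m := by
      have : (n : ℝ) ≤ 8 * m := by exact_mod_cast (by omega : n ≤ 8 * m)
      linarith
    have hm2 : (m : ℝ) ≤ n / 4 := by
      have : 4 * (m : ℝ) ≤ n := by exact_mod_cast (by omega : 4 * m ≤ n)
      linarith
    -- With m of order n, k = g²y makes km³q⁵ of order g². The constant 512 = 8³ reflects m ≥ n/8.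
    set y : ℝ := 1 / ((n : ℝ) ^ 3 * s ^ 15) with hy
    have hy0 : 0 < y := by positivity
    have hk1 : g ^ 2 * y ≤ (⌈g ^ 2 * y⌉₊ : ℝ) := Nat.le_ceil _
    have hk2 : (⌈g ^ 2 * y⌉₊ : ℝ) < g ^ 2 * y + 1 := Nat.ceil_lt_add_one (by positivity)
    have hk0 : 0 < ⌈g ^ 2 * y⌉₊ := Nat.ceil_pos.2 (by positivity)
    generalize ⌈g ^ 2 * y⌉₊ = k at *
    have hk0' : (1 : ℝ) ≤ k := by exact_mod_cast hk0
    -- Failure of the one-centre case keeps y from being too small, so rounding k up to an integer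
    -- costs only a bounded multiple of g³y.
    have hone : 1 ≤ 64 * g ^ 3 * y := by
      rw [hy, mul_one_div, one_le_div (by positivity)]
      calc (n : ℝ) ^ 3 * s ^ 15 = (n * s ^ 5) ^ 3 := by ring
        _ ≤ (4 * g) ^ 3 := by gcongr
        _ = _ := by ring
    have hk3 : (k : ℝ) ≤ 65 * g ^ 3 * y := by
      have : g ^ 2 * y ≤ g ^ 3 * y := by
        gcongr ?_ * y
        exact pow_le_pow_right₀ hg1 (by norm_num)
      linarith
    have hyn : y ≤ n / g ^ 5 := by
      rw [hy, div_le_div_iff₀ (by positivity) (by positivity)]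
      calc 1 * g ^ 5 ≤ (n : ℝ) ^ 4 * s ^ 15 := by linarith
        _ = _ := by ring
    have hns6 : n * s ^ 6 ≤ 4 * g := by
      calc n * s ^ 6 ≤ n * s ^ 5 := by gcongr ?_ * ?_; exact hspow 5 6 (by norm_num)
        _ ≤ _ := hsparse.le
    refine ⟨k, m, hk0, by omega, ?_, ?_, ?_, ?_, ?_, ?_, ?_⟩
    · have : (k : ℝ) ≤ n / 4 := by
        calc (k : ℝ) ≤ 65 * g ^ 3 * (n / g ^ 5) := hk3.trans (by gcongr)
          _ = 65 / g ^ 2 * n := by field_simp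
          -- This is where `17 ≤ g` is needed: g² must be at least 260.
          _ ≤ 1 / 4 * n := by
            gcongr ?_ * (n : ℝ)
            rw [div_le_div_iff₀ (by positivity) (by norm_num)]
            nlinarith
          _ = _ := by ring
      have : (k : ℝ) + 3 * m ≤ n := by linarith
      exact_mod_cast this
    · calc g / 512 ≤ 1 * (n / 8) * s ^ 3 := by linarith
        _ ≤ _ := by gcongr
    · calc g / 512 ≤ g / 64 := by linarith
        _ ≤ (n * s ^ 3) / 64 := by gcongr
        _ ≤ (n : ℝ) ^ 2 * s ^ 3 / 64 := by
          gcongr ?_ * s ^ 3 / 64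
          nlinarith
        _ = ((n : ℝ) / 8) ^ 2 * s ^ 3 := by ring
        _ ≤ _ := by gcongr
    · calc g / 512 ≤ g ^ 2 / (64 * (4 * g)) := by
            rw [div_le_div_iff₀ (by norm_num) (by positivity)]; nlinarith
        _ ≤ g ^ 2 / (64 * (n * s ^ 6)) := by gcongr
        _ = g ^ 2 * y * ((n : ℝ) / 8) ^ 2 * (s ^ 3) ^ 3 := by rw [hy]; field_simp; norm_num
        _ ≤ _ := by gcongr
    · calc g / 512 ≤ g ^ 2 / 512 := by gcongr
        _ ≤ (n * s ^ 3) ^ 2 / 512 := by gcongr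
        _ = 1 * ((n : ℝ) ^ 2 * s ^ 6 / 512) := by ring
        _ ≤ n * ((n : ℝ) ^ 2 * s ^ 6 / 512) := by gcongr; linarith
        _ = ((n : ℝ) / 8) ^ 3 * (s ^ 3) ^ 2 := by ring
        _ ≤ _ := by gcongr
    · calc g / 512 ≤ g ^ 2 / 512 := by gcongr
        _ = g ^ 2 * y * ((n : ℝ) / 8) ^ 3 * (s ^ 3) ^ 5 := by rw [hy]; field_simp; norm_num
        _ ≤ _ := by gcongr
    · set z : ℝ := 1 / ((n : ℝ) ^ 2 * s ^ 12) with hz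
      have hz0 : 0 < z := by positivity
      have e1 : (k : ℝ) * m * s ^ 3 ≤ 17 * g ^ 3 * z := by
        calc _ ≤ 65 * g ^ 3 * y * (n / 4) * s ^ 3 := by gcongr
          _ = 65 / 4 * g ^ 3 * z := by rw [hy, hz]; field_simp
          _ ≤ _ := by gcongr; norm_num
      have e2 : (k : ℝ) * m ^ 2 * (s ^ 3) ^ 3 ≤ 17 * g ^ 4 * z := by
        calc _ ≤ 65 * g ^ 3 * y * (n / 4) ^ 2 * (s ^ 3) ^ 3 := by gcongr
          _ = 65 / 16 * g ^ 3 * z * (n * s ^ 6) := by rw [hy, hz]; field_simp; norm_num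
          _ ≤ 65 / 16 * g ^ 3 * z * (4 * g) := by gcongr
          _ = 65 / 4 * g ^ 4 * z := by ring
          _ ≤ _ := by gcongr; norm_num
      have hg4 : g ^ 3 ≤ g ^ 4 := pow_le_pow_right₀ hg1 (by norm_num)
      calc _ ≤ 24 * (17 * g ^ 3 * z) + 1024 * (17 * g ^ 4 * z) := by linarith
        _ ≤ 24 * (17 * g ^ 4 * z) + 1024 * (17 * g ^ 4 * z) := by gcongr
        _ = 17816 * g ^ 4 * z := by ring
        _ ≤ 20000 * g ^ 4 * z := by gcongr; norm_num
        _ ≤ _ := by gcongr; exact le_max_left _ _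

/-- The chosen parameters cost at most 20000g⁴ times the threshold, while the fifth root in `hgb`
provides a budget of g⁵ times it. Markov's inequality therefore leaves 20000/g; the five overlap
terms contribute 64 · 5 · 512 / g. -/
lemma exists_strategy_of_large {g : ℝ} (ht : 10 ≤ t) (htN : t ≤ n.choose 2) (hb : 0 < b)
    (hg : 17 ≤ g) (hgt : g ≤ (t : ℝ) / (n : ℝ) ^ (6 / 5 : ℝ))
    (hgb : g ≤ ((b : ℝ) / budgetThreshold n t) ^ (1 / 5 : ℝ)) :
    ∃ B : Strategy n t b, B.IsGraphBased ∧
      1 - RandomizedStrategy.probDiamond (PMF.pure B) ≤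
        ((t : ℝ) / (t - 9)) ^ 20 * (1 + 163840 / g) - 1 + 20000 / g := by
  have ht' : (10 : ℝ) ≤ t := by exact_mod_cast ht
  have hb' : (0 : ℝ) < b := by exact_mod_cast hb
  have hg0 : 0 < g := by linarith
  have hn : 2 ≤ n := by
    by_contra h
    have : n.choose 2 = 0 := Nat.choose_eq_zero_of_lt (by omega)
    omega
  have hn0 : (0 : ℝ) < n := by exact_mod_cast (by omega : 0 < n)
  have hN2 := choose_two_le_sq_div_two (n := n)
  have htN' : (t : ℝ) ≤ n.choose 2 := by exact_mod_cast htN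
  set q : ℝ := t / (n : ℝ) ^ 2 with hq
  have hq0 : 0 < q := by positivity
  have hq1 : q ≤ 1 := by
    rw [hq, div_le_one (by positivity)]
    nlinarith
  set s : ℝ := q ^ (1 / 3 : ℝ) with hs
  have hs3 : s ^ 3 = q := by
    rw [hs, ← Real.rpow_mul_natCast hq0.le]; norm_num
  have hs0 : 0 < s := by positivity
  have hs1 : s ≤ 1 := Real.rpow_le_one hq0.le hq1 (by norm_num)
  have hpow : ((n : ℝ) ^ (6 / 5 : ℝ)) ^ 5 = (n : ℝ) ^ 6 := by
    rw [← Real.rpow_mul_natCast (by positivity), ← Real.rpow_natCast]; norm_num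
  have h5 : g ^ 5 ≤ (n : ℝ) ^ 4 * s ^ 15 := by
    calc g ^ 5 ≤ ((t : ℝ) / (n : ℝ) ^ (6 / 5 : ℝ)) ^ 5 := by gcongr
      _ = (t : ℝ) ^ 5 / (n : ℝ) ^ 6 := by rw [div_pow, hpow]
      _ = (n : ℝ) ^ 4 * (s ^ 3) ^ 5 := by rw [hs3, hq]; field_simp
      _ = _ := by ring
  obtain ⟨k, m, hk, hm, hkm, c1, c2, c3, c4, c5, c6⟩ := exists_parameters hs0 hs1 hg h5
  rw [hs3] at c1 c2 c3 c4 c5 c6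
  have hthr : max (1 / ((n : ℝ) ^ 2 * s ^ 12)) (1 / s ^ 2) = budgetThreshold n t := by
    unfold budgetThreshold
    congr 1
    · have : s ^ 12 = q ^ 4 := by rw [← hs3]; ring
      rw [this, hq]; field_simp
    · have : s ^ 2 = q ^ (2 / 3 : ℝ) := by
        rw [hs, ← Real.rpow_mul_natCast hq0.le]; norm_num
      have h2 : ((n : ℝ) ^ 2) ^ (2 / 3 : ℝ) = (n : ℝ) ^ (4 / 3 : ℝ) := by
        rw [← Real.rpow_natCast_mul (by positivity)]; norm_num
      rw [this, hq, Real.div_rpow (by positivity) (by positivity), h2, one_div_div]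
  rw [hthr] at c6
  have hT0 : 0 < budgetThreshold n t := by
    rw [← hthr]; exact lt_max_of_lt_right (by positivity)
  have hgb5 : g ^ 5 ≤ (b : ℝ) / budgetThreshold n t := by
    calc g ^ 5 ≤ (((b : ℝ) / budgetThreshold n t) ^ (1 / 5 : ℝ)) ^ 5 := by gcongr
      _ = _ := by rw [← Real.rpow_mul_natCast (by positivity)]; norm_num
  obtain ⟨B, hB, hfail⟩ := exists_strategy ht htN hk hm hb hkm hq
  refine ⟨B, hB, hfail.trans ?_⟩
  have inv_le : ∀ x : ℝ, g / 512 ≤ x → 1 / x ≤ 512 / g := fun x hx => by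
    rw [← one_div_div g 512]
    exact one_div_le_one_div_of_le (by positivity) hx
  have p4 : (0 : ℝ) ≤ (t : ℝ) / (t - 9) := div_nonneg (by linarith) (by linarith)
  refine add_le_add (sub_le_sub_right (mul_le_mul_of_nonneg_left ?_ (by positivity)) 1) ?_
  · have := inv_le _ c1
    have := inv_le _ c2
    have := inv_le _ c3
    have := inv_le _ c4
    have := inv_le _ c5
    have : (163840 : ℝ) / g = 320 * (512 / g) := by ring
    linarith
  · rw [div_le_div_iff₀ hb' hg0]
    rw [le_div_iff₀ hT0] at hgb5
    calc _ ≤ 20000 * g ^ 4 * budgetThreshold n t * g := by gcongr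
      _ = 20000 * (g ^ 5 * budgetThreshold n t) := by ring
      _ ≤ _ := by gcongr

theorem exists_strategy_tendsto (t b : ℕ → ℕ) (ht : ∀ n, t n ≤ n.choose 2)
    (h1 : Tendsto (fun n : ℕ => (t n : ℝ) / (n : ℝ) ^ (6 / 5 : ℝ)) atTop atTop)
    (h2 : Tendsto (fun n : ℕ => (b n : ℝ) / budgetThreshold n (t n)) atTop atTop) :
    ∃ B : ∀ n, Strategy n (t n) (b n), (∀ n, (B n).IsGraphBased) ∧
      Tendsto (fun n => RandomizedStrategy.probDiamond (PMF.pure (B n))) atTop (𝓝 1) := by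
  classical
  -- A single margin tending to infinity serves both the time and the budget hypotheses.
  set g : ℕ → ℝ := fun n => min ((t n : ℝ) / (n : ℝ) ^ (6 / 5 : ℝ))
    (((b n : ℝ) / budgetThreshold n (t n)) ^ (1 / 5 : ℝ)) with hg
  have h2' := (tendsto_rpow_atTop (by norm_num : (0 : ℝ) < 1 / 5)).comp h2
  have hgtop : Tendsto g atTop atTop := by
    refine tendsto_atTop.2 fun C => ?_
    filter_upwards [h1.eventually_ge_atTop C, h2'.eventually_ge_atTop C] with n a1 a2
    exact le_min a1 a2
  have httop : Tendsto (fun n => (t n : ℝ)) atTop atTop := by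
    refine tendsto_atTop_mono' _ ?_ h1
    filter_upwards [eventually_ge_atTop 1] with n hn
    exact div_le_self (by positivity)
      (Real.one_le_rpow (by exact_mod_cast hn) (by norm_num))
  set ε : ℕ → ℝ := fun n =>
    ((t n : ℝ) / (t n - 9)) ^ 20 * (1 + 163840 / g n) - 1 + 20000 / g n with hε
  have hεlim : Tendsto ε atTop (𝓝 0) := by
    have e1 : Tendsto (fun n => (t n : ℝ) / (t n - 9)) atTop (𝓝 1) := by
      have : Tendsto (fun n => 1 + 9 / ((t n : ℝ) - 9)) atTop (𝓝 (1 + 0)) :=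
        tendsto_const_nhds.add (tendsto_const_nhds.div_atTop
          (tendsto_atTop_add_const_right _ (-9) httop))
      rw [add_zero] at this
      refine this.congr' ?_
      filter_upwards [httop.eventually_gt_atTop 9] with n hn
      have : (t n : ℝ) - 9 ≠ 0 := by linarith
      field_simp
      ring
    have e2 : Tendsto (fun n => (163840 : ℝ) / g n) atTop (𝓝 0) :=
      tendsto_const_nhds.div_atTop hgtop
    have e3 : Tendsto (fun n => (20000 : ℝ) / g n) atTop (𝓝 0) :=
      tendsto_const_nhds.div_atTop hgtop
    have := (((e1.pow 20).mul (e2.const_add 1)).sub_const 1).add e3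
    simpa using this
  have hex : ∀ n, ∃ B : Strategy n (t n) (b n), B.IsGraphBased ∧
      ((10 ≤ t n ∧ 0 < b n ∧ 17 ≤ g n) →
        1 - RandomizedStrategy.probDiamond (PMF.pure B) ≤ ε n) := by
    intro n
    by_cases h : 10 ≤ t n ∧ 0 < b n ∧ 17 ≤ g n
    · obtain ⟨B, hB, hB'⟩ := exists_strategy_of_large h.1 (ht n) h.2.1 h.2.2 (min_le_left _ _)
        (min_le_right _ _)
      exact ⟨B, hB, fun _ => hB'⟩
    -- Outside the parameter range, which is eventually entered, the strategy that never buys serves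
    -- as a default.
    · exact ⟨⟨fun _ => ∅, by simp, by simp, by simp⟩, fun _ _ _ _ _ => Iff.rfl, fun h' => absurd h' h⟩
  choose B hB hB' using hex
  refine ⟨B, hB, ?_⟩
  have hle : ∀ᶠ n in atTop, 1 - ε n ≤ RandomizedStrategy.probDiamond (PMF.pure (B n)) := by
    filter_upwards [httop.eventually_ge_atTop 10, h2.eventually_gt_atTop 0,
      hgtop.eventually_ge_atTop 17] with n a1 a2 a3
    have hb : 0 < b n := by
      rcases Nat.eq_zero_or_pos (b n) with h | h
      · rw [h] at a2; simp at a2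
      · exact h
    have := hB' n ⟨by exact_mod_cast a1, hb, a3⟩
    linarith
  have hlim : Tendsto (fun n => 1 - ε n) atTop (𝓝 1) := by
    simpa using hεlim.const_sub 1
  refine tendsto_of_tendsto_of_tendsto_of_le_of_le' hlim tendsto_const_nhds hle
    (Eventually.of_forall fun n => ?_)
  rw [probDiamond_pure]
  exact orderProb_le_one _

end lower

theorem theorem3 (t b : ℕ → ℕ) (ht : ∀ n, t n ≤ n.choose 2) :
    (Tendsto (fun n : ℕ => (t n : ℝ) / (n : ℝ) ^ (6 / 5 : ℝ)) atTop atTop →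
      Tendsto (fun n : ℕ => (b n : ℝ) / budgetThreshold n (t n)) atTop atTop →
        ∃ B : ∀ n, Strategy n (t n) (b n), (∀ n, (B n).IsGraphBased) ∧
          Tendsto (fun n => RandomizedStrategy.probDiamond (PMF.pure (B n))) atTop (𝓝 1)) ∧
    (Tendsto (fun n : ℕ => (t n : ℝ) / (n : ℝ) ^ (6 / 5 : ℝ)) atTop (𝓝 0) ∨
        Tendsto (fun n : ℕ => (b n : ℝ) / budgetThreshold n (t n)) atTop (𝓝 0) →
      ∀ B : ∀ n, RandomizedStrategy n (t n) (b n),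
        Tendsto (fun n => (B n).probDiamond) atTop (𝓝 0)) := by
  refine ⟨exists_strategy_tendsto t b ht, ?_⟩
  rintro (h | h)
  · exact tendsto_probDiamond_of_few_edges t b h
  · exact tendsto_probDiamond_of_low_budget t b h
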